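/- Let $n\ge 1$, $m>0$, $j\in\{1,\dots,n\}$. For $\mathbf p\in\mathbb R^n$ with components $p^1,\dots,p^n$ put $p_j=-p^j$ (signature $(+,-,\dots,-)$), $p_kx^k=\sum_{k=1}^n p_kx^k=-\mathbf p\cdot\mathbf x$, $\omega_{\mathbf p}=\sqrt{|\mathbf p|^2+m^2}$ and $d\mu(\mathbf p)=d^n\mathbf p/(2\omega_{\mathbf p})$. On the bosonic Fock space over $L^2(\mathbb R^n,d\mu)$ let $\mathscr D$ be the space of finite-particle vectors $\Psi=(\Psi_k)_k$ whose components are symmetric Schwartz functions of $k$ momenta. Let $(a_c(\mathbf p)\Psi)_k(\mathbf p_1,\dots,\mathbf p_k)=\sqrt{k+1}\,\Psi_{k+1}(\mathbf p,\mathbf p_1,\dots,\mathbf p_k)$, $a(\mathbf p)=a_c(\mathbf p)/\sqrt{2\omega_{\mathbf p}}$, let $a^*(\mathbf p)$ be the corresponding creation operators (operator-valued distributions with $[a(\mathbf p),a^*(\mathbf q)]=\delta^n(\mathbf p-\mathbf q)$), and let $$\tilde a(\mathbf x)=(2\pi)^{-n/2}\int d^n\mathbf p\,e^{-ip_kx^k}a(\mathbf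 p),\qquad \tilde a^*(\mathbf x)=(2\pi)^{-n/2}\int d^n\mathbf p\,e^{ip_kx^k}a^*(\mathbf p)$$ be the ladder operators of the coordinate space. Consider on $\mathscr D$ $$P_0=\int d^n\mathbf p\,\omega_{\mathbf p}\,a^*(\mathbf p)a(\mathbf p),\qquad X_j=-i\int d^n\mathbf p\,a^*(\mathbf p)\frac{\partial}{\partial p^j}a(\mathbf p),\qquad V_j=\int d^n\mathbf p\,\frac{p_j}{\omega_{\mathbf p}}\,a^*(\mathbf p)a(\mathbf p).$$ Then the velocity operator $V_j$ is, in terms of the ladder operators of the coordinate space, $$V_j=-i\int d^n\mathbf x\,\tilde a^*(\mathbf x)\,(\tilde\omega_j\ast\tilde a)(\mathbf x),\qquad \tilde\omega_j(\mathbf x)=2(2\pi)^{-\frac{n+1}{2}}\Big(\frac{m}{|\mathbf x|}\Big)^{\frac{n+1}{2}}K_{\frac{n+1}{2}}(m|\mathbf x|)\,x^j,$$ where $x^j$ is the $j$-th Cartesian component of $\mathbf x$, $K_\nu$ is the modified Bessel function of the second kind, and the convolution is the principal value $$(\tilde\omega_j\ast\tilde a)(\mathbf x)=\lim_{\varepsilon\downarrow0}\int_{|\mathbf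 x-\mathbf y|>\varepsilon}d^n\mathbf y\,\tilde\omega_j(\mathbf x-\mathbf y)\,\tilde a(\mathbf y).$$ In detail: on every $\Psi\in\mathscr D$, componentwise and pointwise, the truncated integrals converge absolutely, the limit exists for every $\mathbf x$ and is integrable in $\mathbf x$. The identity holds as an identity of operators applied to $\Psi\in\mathscr D$. It also holds in the sense of forms: for all $\Phi,\Psi\in\mathscr D$, with absolutely convergent integrals over $\mathbf p$ and $\mathbf x$, $$\langle\Phi,V_j\Psi\rangle=\int d^n\mathbf p\,\frac{p_j}{\omega_{\mathbf p}}\langle a(\mathbf p)\Phi,a(\mathbf p)\Psi\rangle=-i\int d^n\mathbf x\,\langle\tilde a(\mathbf x)\Phi,(\tilde\omega_j\ast\tilde a)(\mathbf x)\Psi\rangle.$$ Moreover $V_j$ satisfies the Heisenberg equation $[P_0,X_j]=-iV_j$ on $\mathscr D$. -/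

import Mathlib

open MeasureTheory Filter Topology
open scoped SchwartzMap ComplexConjugate

noncomputable section

/-- Momentum space and coordinate space `ℝⁿ`; `x j` is the contravariant (Cartesian) component
`x^j`. -/
abbrev Vec (n : ℕ) : Type := EuclideanSpace ℝ (Fin n)

/-- The covariant component `p_j = -p^j` of a spatial vector, for the signature `(+,-,…,-)`. -/
def lowerIdx {n : ℕ} (p : Vec n) (j : Fin n) : ℝ := -(p j)

/-- The contraction `p_k x^k`, summed over the spatial indices. -/
def contr {n : ℕ} (p x : Vec n) : ℝ := ∑ k, lowerIdx p k * x k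

/-- The energy `ω_p = √(|p|² + m²)`. -/
def energy {n : ℕ} (m : ℝ) (p : Vec n) : ℝ := Real.sqrt (‖p‖ ^ 2 + m ^ 2)

/-- The modified Bessel function of the second kind,
`K_ν(z) = ∫₀^∞ exp(-z cosh t) cosh(ν t) dt`, for `z > 0`. -/
def besselK (ν z : ℝ) : ℝ :=
  ∫ t in Set.Ioi (0 : ℝ), Real.exp (-z * Real.cosh t) * Real.cosh (ν * t)

/-- Sequences `(Ψ_k)_k` of `k`-particle wave functions of the momenta, in the covariant
normalization. -/
abbrev WaveSeq (n : ℕ) : Type := (k : ℕ) → (Fin k → Vec n) → ℂ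

/-- Finite-particle vectors of the bosonic Fock space with symmetric Schwartz wave functions. -/
structure IsSchwartzFock {n : ℕ} (Ψ : WaveSeq n) : Prop where
  schwartz : ∀ k, ∃ f : 𝓢(Fin k → Vec n, ℂ), ∀ q, Ψ k q = f q
  symmetric : ∀ k (σ : Equiv.Perm (Fin k)) (q : Fin k → Vec n), Ψ k (q ∘ σ) = Ψ k q
  finite : ∃ N, ∀ k, N < k → Ψ k = 0

/-- The scalar product of Fock space,
`∑_k ∫ dμ(p₁) ⋯ ∫ dμ(p_k) conj(Φ_k) Ψ_k` with `dμ(p) = dp / (2 ω_p)`. -/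
def fockInner {n : ℕ} (m : ℝ) (Φ Ψ : WaveSeq n) : ℂ :=
  ∑' k, ∫ q : Fin k → Vec n,
    ((∏ i, (2 * energy m (q i))⁻¹ : ℝ) : ℂ) * (conj (Φ k q) * Ψ k q)

/-- The covariant annihilation operator with sharp momentum,
`(a_c(p)Ψ)_k(p₁,…,p_k) = √(k+1) Ψ_{k+1}(p,p₁,…,p_k)`. -/
def annCov {n : ℕ} (p : Vec n) (Ψ : WaveSeq n) : WaveSeq n :=
  fun k q => (Real.sqrt (k + 1) : ℂ) * Ψ (k + 1) (Fin.cons p q)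

/-- The smeared covariant creation operator `a_c(f)* = ∫ dμ(p) f(p) a_c*(p)`. -/
def creCov {n : ℕ} (f : Vec n → ℂ) (Ψ : WaveSeq n) : WaveSeq n
  | 0, _ => 0
  | k + 1, q => ((Real.sqrt (k + 1))⁻¹ : ℂ) *
      ∑ i : Fin (k + 1), f (q i) * Ψ k (q ∘ i.succAbove)

/-- The non-covariant annihilation operator `a(p) = a_c(p) / √(2ω_p)`. -/
def ann {n : ℕ} (m : ℝ) (p : Vec n) (Ψ : WaveSeq n) : WaveSeq n :=
  ((Real.sqrt (2 * energy m p))⁻¹ : ℂ) • annCov p Ψ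

/-- The vector `∫ dp a*(p) F(p)`, where `a*(p) = a_c*(p) / √(2ω_p)`, for a family `F` of Fock space
vectors: the linear extension of `a_c(f)*Ψ = ∫ dμ(p) a_c*(p) f(p)Ψ` from `f(p)Ψ` to general
families (see `creInt_smul`). -/
def creInt {n : ℕ} (m : ℝ) (F : Vec n → WaveSeq n) : WaveSeq n
  | 0, _ => 0
  | k + 1, q => ((Real.sqrt (k + 1))⁻¹ : ℂ) *
      ∑ i : Fin (k + 1),
        (Real.sqrt (2 * energy m (q i)) : ℂ) * F (q i) k (q ∘ i.succAbove)

theorem energy_pos {n : ℕ} {m : ℝ} (hm : 0 < m) (p : Vec n) : 0 < energy m p :=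
  Real.sqrt_pos.2 (by positivity)

/-- `∫ dp a*(p) (2ω_p)^{-1/2} f(p) Ψ = ∫ dμ(p) f(p) a_c*(p) Ψ = a_c(f)*Ψ`. -/
theorem creInt_smul {n : ℕ} {m : ℝ} (hm : 0 < m) (f : Vec n → ℂ) (Ψ : WaveSeq n) :
    creInt m (fun p => (f p / (Real.sqrt (2 * energy m p) : ℂ)) • Ψ) = creCov f Ψ := by
  funext k q
  cases k with
  | zero => rfl
  | succ k =>
    simp only [creInt, creCov, Pi.smul_apply, smul_eq_mul]
    congr 1
    refine Finset.sum_congr rfl fun i _ => ?_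
    have h : (Real.sqrt (2 * energy m (q i)) : ℂ) ≠ 0 := by
      have := energy_pos hm (q i)
      exact_mod_cast (Real.sqrt_pos.2 (by positivity)).ne'
    field_simp

/-- The energy operator `P_0 = ∫ dp ω_p a*(p) a(p)`. -/
def opP0 {n : ℕ} (m : ℝ) (Ψ : WaveSeq n) : WaveSeq n :=
  creInt m fun p => (energy m p : ℂ) • ann m p Ψ

/-- The Newton-Wigner-Pryce operator `X_j = -i ∫ dp a*(p) (∂/∂p^j) a(p)`. -/
def opX {n : ℕ} (m : ℝ) (j : Fin n) (Ψ : WaveSeq n) : WaveSeq n :=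
  (-Complex.I) • creInt m fun p k q =>
    fderiv ℝ (fun p' : Vec n => ann m p' Ψ k q) p (EuclideanSpace.single j (1 : ℝ))

/-- The velocity operator `V_j = ∫ dp (p_j / ω_p) a*(p) a(p)`. -/
def opV {n : ℕ} (m : ℝ) (j : Fin n) (Ψ : WaveSeq n) : WaveSeq n :=
  creInt m fun p => ((lowerIdx p j / energy m p : ℝ) : ℂ) • ann m p Ψ

/-- The annihilation operator of coordinate space,
`ã(x) = (2π)^{-n/2} ∫ dp e^{-i p_k x^k} a(p)`. -/
def annX {n : ℕ} (m : ℝ) (x : Vec n) (Ψ : WaveSeq n) : WaveSeq n :=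
  fun k q => (((2 * Real.pi) ^ (-(n : ℝ) / 2) : ℝ) : ℂ) *
    ∫ p : Vec n, Complex.exp (-(Complex.I * (contr p x : ℂ))) * ann m p Ψ k q

/-- The vector `∫ dx ã*(x) G(x)` for a family `G` of Fock space vectors, with
`ã*(x) = (2π)^{-n/2} ∫ dp e^{i p_k x^k} a*(p)`. -/
def creIntX {n : ℕ} (m : ℝ) (G : Vec n → WaveSeq n) : WaveSeq n :=
  creInt m fun p k q => (((2 * Real.pi) ^ (-(n : ℝ) / 2) : ℝ) : ℂ) *
    ∫ x : Vec n, Complex.exp (Complex.I * (contr p x : ℂ)) * G x k q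

/-- The kernel `ω̃_j(x) = 2 (2π)^{-(n+1)/2} (m/|x|)^{(n+1)/2} K_{(n+1)/2}(m|x|) x^j`. -/
def velKernel {n : ℕ} (m : ℝ) (j : Fin n) (x : Vec n) : ℝ :=
  2 * (2 * Real.pi) ^ (-((n : ℝ) + 1) / 2) * (m / ‖x‖) ^ (((n : ℝ) + 1) / 2) *
    besselK (((n : ℝ) + 1) / 2) (m * ‖x‖) * x j

/-- The integrand `y ↦ ω̃_j(x-y) ã(y)Ψ` of the convolution, in a component. -/
def velConvIntegrand {n : ℕ} (m : ℝ) (j : Fin n) (Ψ : WaveSeq n) (x : Vec n)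
    (k : ℕ) (q : Fin k → Vec n) (y : Vec n) : ℂ :=
  (velKernel m j (x - y) : ℂ) * annX m y Ψ k q

/-- The convolution integral with the ball of radius `ε` about the singularity `y = x` removed. -/
def velConvTrunc {n : ℕ} (m : ℝ) (j : Fin n) (ε : ℝ) (x : Vec n) (Ψ : WaveSeq n) : WaveSeq n :=
  fun k q => ∫ y in {y : Vec n | ε < ‖x - y‖}, velConvIntegrand m j Ψ x k q y

/-- The convolution `(ω̃_j ∗ ã)(x)Ψ`, a principal value because `|ω̃_j|` behaves as `|x|^{-n}`
at the origin. -/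
def velConv {n : ℕ} (m : ℝ) (j : Fin n) (x : Vec n) (Ψ : WaveSeq n) : WaveSeq n :=
  fun k q => limUnder (𝓝[>] (0 : ℝ)) fun ε => velConvTrunc m j ε x Ψ k q

end

open scoped FourierTransform

/-! ### The modified Bessel function as a Laplace-type integral -/

/-! The plane wave `e^{-i p_k x^k} = e^{i p·x}` is an eigenfunction of the principal value
convolution with `ω̃_j`, with eigenvalue `i p_j/ω_p`. Convolving `ã` therefore amounts to
multiplying `a(p)` by `i p_j/ω_p` under the Fourier integral, and the prefactor `-i` turns this into
`V_j`.

The eigenvalue: `ω̃_j` is odd, so over a symmetric truncation only the sine transform survives. The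
bound `|sin(p·z)| ≤ |p||z|` supplies the factor `|z|` that makes the kernel integrable, so the
truncated transforms are bounded by `C|p|` uniformly in `ε` and converge to the full sine transform.
Its value `p^j/ω_p` (`integral_velKernel_mul_sin`) comes from writing the Bessel function as a
superposition of Gaussians over a parameter `s > 0` (`velKernel_eq`): each Gaussian is transformed
explicitly, and `∫ s^{-1/2} e^{-sω²} ds = √π/ω` adds up the results. For a superposition of plane
waves with amplitude `g`, the dominating function `C|p||g(p)|` lets `ε → 0` pass under the integral
(`tendsto_setIntegral_velKernel_mul_waveSum`).

On Fock space the remaining momenta `q` are frozen, and `p ↦ (a(p)Ψ)(q)` is a Schwartz function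
(`IsSchwartzFock.exists_schwartz_ann`). The operator identity is then Fourier inversion; the form
identity is Plancherel for each `q` followed by Fubini in `q`. The momentum form rests on `V_j`
being multiplication by `∑_i p_j/ω` on symmetric functions (`opV_apply`). The Heisenberg equation is
the product rule with `∂ω/∂p^j = p^j/ω = -p_j/ω`. -/

theorem one_add_sq_div_four_le_cosh (u : ℝ) : 1 + u ^ 2 / 4 ≤ Real.cosh u := by
  have h1 := Real.quadratic_le_exp_of_nonneg (abs_nonneg u)
  have h2 := Real.add_one_le_exp (-|u|)
  rw [← Real.cosh_abs, Real.cosh_eq]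
  rw [sq_abs] at h1
  linarith

/-- The quadratic lower bound for `cosh` gives domination by the Gaussian `exp(νu - z u²/4)`. -/
theorem integrable_exp_mul_exp_neg_mul_cosh (ν : ℝ) {z : ℝ} (hz : 0 < z) :
    Integrable fun u : ℝ => Real.exp (ν * u) * Real.exp (-z * Real.cosh u) := by
  have hb : (0 : ℝ) < ((z / 4 : ℝ) : ℂ).re := by rw [Complex.ofReal_re]; positivity
  have h := (integrable_cexp_quadratic hb (ν : ℂ) 0).norm
  refine h.mono' (by fun_prop) (ae_of_all _ fun u => ?_)
  rw [Complex.norm_exp, Real.norm_of_nonneg (by positivity), ← Real.exp_add]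
  refine Real.exp_le_exp.2 ?_
  have h1 := one_add_sq_div_four_le_cosh u
  have h2 : (-((z / 4 : ℝ) : ℂ) * (u : ℂ) ^ 2 + (ν : ℂ) * u + 0).re = -(z / 4) * u ^ 2 + ν * u := by
    have : (-((z / 4 : ℝ) : ℂ) * (u : ℂ) ^ 2 + (ν : ℂ) * u + 0)
        = ((-(z / 4) * u ^ 2 + ν * u : ℝ) : ℂ) := by push_cast; ring
    rw [this, Complex.ofReal_re]
  rw [h2]
  nlinarith [mul_le_mul_of_nonneg_left h1 hz.le]

/-- Averaging over `u ↦ -u` replaces the exponential by `cosh (νu)`, and the even integrand is twice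
its half-line integral. -/
theorem integral_exp_mul_exp_neg_mul_cosh (ν : ℝ) {z : ℝ} (hz : 0 < z) :
    ∫ u : ℝ, Real.exp (-ν * u) * Real.exp (-z * Real.cosh u) = 2 * besselK ν z := by
  have h1 := integrable_exp_mul_exp_neg_mul_cosh ν hz
  have h2 := integrable_exp_mul_exp_neg_mul_cosh (-ν) hz
  have h3 : ∫ u : ℝ, Real.exp (ν * u) * Real.exp (-z * Real.cosh u)
      = ∫ u : ℝ, Real.exp (-ν * u) * Real.exp (-z * Real.cosh u) := by
    rw [← integral_neg_eq_self]
    simp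
  have h4 := integral_comp_abs (f := fun u : ℝ => Real.exp (-z * Real.cosh u) * Real.cosh (ν * u))
  have h5 : ∀ u : ℝ, Real.exp (-z * Real.cosh |u|) * Real.cosh (ν * |u|)
      = (1 / 2) * (Real.exp (ν * u) * Real.exp (-z * Real.cosh u)
        + Real.exp (-ν * u) * Real.exp (-z * Real.cosh u)) := by
    intro u
    have : Real.cosh (ν * |u|) = Real.cosh (ν * u) := by
      rw [← Real.cosh_abs (ν * |u|), abs_mul, abs_abs, ← abs_mul, Real.cosh_abs]
    rw [Real.cosh_abs, this, Real.cosh_eq (ν * u)]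
    ring_nf
  simp only [h5] at h4
  rw [integral_const_mul, integral_add h1 h2, h3] at h4
  rw [besselK, ← h4]
  ring

/-- The substitution `s = (r/2m) e^u` balances the two terms of the exponent: `s m² + r²/4s = m r
cosh u`. -/
theorem integral_rpow_mul_exp_neg_add_div (ν : ℝ) {m r : ℝ} (hm : 0 < m) (hr : 0 < r) :
    ∫ s in Set.Ioi (0 : ℝ), s ^ (-(ν + 1)) * Real.exp (-(s * m ^ 2) - r ^ 2 / (4 * s))
      = 2 * (2 * m / r) ^ ν * besselK ν (m * r) := by
  set a : ℝ := r / (2 * m) with ha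
  have ha0 : 0 < a := by positivity
  have himg : (fun u : ℝ => a * Real.exp u) '' Set.univ = Set.Ioi 0 := by
    ext s
    simp only [Set.image_univ, Set.mem_range, Set.mem_Ioi]
    constructor
    · rintro ⟨u, rfl⟩; positivity
    · intro hs
      exact ⟨Real.log (s / a), by rw [Real.exp_log (by positivity)]; field_simp⟩
  rw [← himg, integral_image_eq_integral_abs_deriv_smul MeasurableSet.univ
    (f' := fun u => a * Real.exp u)
    (fun u _ => ((Real.hasDerivAt_exp u).const_mul a).hasDerivWithinAt)
    (fun u _ v _ h => Real.exp_injective (mul_left_cancel₀ ha0.ne' h)), Measure.restrict_univ]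
  have h : ∀ u : ℝ, |a * Real.exp u| • ((a * Real.exp u) ^ (-(ν + 1)) *
      Real.exp (-((a * Real.exp u) * m ^ 2) - r ^ 2 / (4 * (a * Real.exp u))))
      = (2 * m / r) ^ ν * (Real.exp (-ν * u) * Real.exp (-(m * r) * Real.cosh u)) := by
    intro u
    have hpos : 0 < a * Real.exp u := by positivity
    have e1 : a * Real.exp u * (a * Real.exp u) ^ (-(ν + 1))
        = (2 * m / r) ^ ν * Real.exp (-ν * u) := by
      have : a * Real.exp u * (a * Real.exp u) ^ (-(ν + 1)) = (a * Real.exp u) ^ (-ν) := by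
        rw [show -ν = 1 + -(ν + 1) by ring, Real.rpow_add hpos, Real.rpow_one]
      rw [this, Real.mul_rpow ha0.le (Real.exp_pos u).le, ← Real.exp_mul, Real.rpow_neg ha0.le,
        ← Real.inv_rpow ha0.le, ha, inv_div]
      ring_nf
    have e2 : -((a * Real.exp u) * m ^ 2) - r ^ 2 / (4 * (a * Real.exp u))
        = -(m * r) * Real.cosh u := by
      rw [Real.cosh_eq, Real.exp_neg, ha]
      have := Real.exp_pos u
      field_simp
      ring
    rw [abs_of_pos hpos, smul_eq_mul, ← mul_assoc, e1, e2, mul_assoc]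
  simp only [h]
  rw [integral_const_mul, integral_exp_mul_exp_neg_mul_cosh ν (by positivity)]
  ring

/-! ### The velocity kernel as a superposition of Gaussians -/

/-- The Gaussian weight in `ω̃_j(z) = c z_j ∫₀^∞ s^{-(n+3)/2} exp(-s m² - |z|²/4s) ds`. -/
noncomputable def heatWeight {n : ℕ} (m s : ℝ) (z : Vec n) : ℝ :=
  s ^ (-(((n : ℝ) + 1) / 2 + 1)) * Real.exp (-(s * m ^ 2) - ‖z‖ ^ 2 / (4 * s))

/-- The normalization of the Gaussian superposition for the velocity kernel. -/
noncomputable def velConst (n : ℕ) : ℝ := (4 * Real.pi) ^ (-((n : ℝ) / 2)) / (2 * Real.sqrt Real.pi)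

theorem velConst_nonneg (n : ℕ) : 0 ≤ velConst n := by
  unfold velConst; positivity

theorem velKernel_eq {n : ℕ} {m : ℝ} (hm : 0 < m) (j : Fin n) (z : Vec n) :
    velKernel m j z = velConst n * (z j * ∫ s in Set.Ioi (0 : ℝ), heatWeight m s z) := by
  rcases eq_or_ne z 0 with rfl | hz
  -- At the origin the factor `z j` kills both sides, whatever the values of the singular factors
  -- there.
  · simp [velKernel]
  have hr : 0 < ‖z‖ := norm_pos_iff.2 hz
  simp only [heatWeight]
  rw [integral_rpow_mul_exp_neg_add_div _ hm hr, velKernel, velConst]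
  have h1 : (2 * m / ‖z‖) ^ (((n : ℝ) + 1) / 2)
      = 2 ^ (((n : ℝ) + 1) / 2) * (m / ‖z‖) ^ (((n : ℝ) + 1) / 2) := by
    rw [mul_div_assoc, Real.mul_rpow (by norm_num) (by positivity)]
  have hπ := Real.pi_pos
  have h2 : (2 * Real.pi) ^ (-((n : ℝ) + 1) / 2)
      = (4 * Real.pi) ^ (-((n : ℝ) / 2)) / (2 * Real.sqrt Real.pi) * 2 ^ (((n : ℝ) + 1) / 2) := by
    have e : (2 : ℝ) ^ (-((n : ℝ) + 1) / 2) = (2 ^ (2 : ℝ)) ^ (-((n : ℝ) / 2)) / 2 *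
        2 ^ (((n : ℝ) + 1) / 2) := by
      rw [← Real.rpow_mul (by norm_num), div_mul_eq_mul_div, ← Real.rpow_add (by norm_num),
        ← Real.rpow_sub_one (by norm_num)]
      ring_nf
    rw [Real.mul_rpow (by norm_num) hπ.le, Real.mul_rpow (by norm_num) hπ.le, e,
      Real.sqrt_eq_rpow, show (4 : ℝ) = 2 ^ (2 : ℝ) by norm_num,
      show -((n : ℝ) + 1) / 2 = -((n : ℝ) / 2) - 1 / 2 by ring, Real.rpow_sub hπ]
    field_simp
  rw [h1, h2]
  ring

theorem velKernel_neg {n : ℕ} (m : ℝ) (j : Fin n) (z : Vec n) :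
    velKernel m j (-z) = -velKernel m j z := by
  simp [velKernel]

theorem measurable_heatWeight {n : ℕ} (m : ℝ) :
    Measurable fun x : ℝ × Vec n => heatWeight m x.1 x.2 := by
  unfold heatWeight
  fun_prop

theorem heatWeight_nonneg {n : ℕ} (m : ℝ) {s : ℝ} (hs : 0 < s) (z : Vec n) :
    0 ≤ heatWeight m s z := by
  unfold heatWeight; positivity

theorem stronglyMeasurable_velKernel {n : ℕ} {m : ℝ} (hm : 0 < m) (j : Fin n) :
    StronglyMeasurable (velKernel (n := n) m j) := by
  have h : StronglyMeasurable fun z : Vec n => ∫ s in Set.Ioi (0 : ℝ), heatWeight m s z :=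
    (measurable_heatWeight m).stronglyMeasurable.integral_prod_left
  have h2 : velKernel (n := n) m j
      = fun z => velConst n * (z j * ∫ s in Set.Ioi (0 : ℝ), heatWeight m s z) :=
    funext (velKernel_eq hm j)
  rw [h2]
  have h3 : StronglyMeasurable fun z : Vec n => z j :=
    Measurable.stronglyMeasurable (by fun_prop)
  exact (h3.mul h).const_mul _

/-- Half of the Gaussian absorbs `|z|²`: with `t = |z|²/8s`, `t ≤ e^t` trades `|z|²` for `8s`, hence
for one power of `s`. -/
theorem sq_norm_mul_heatWeight_le {n : ℕ} (m : ℝ) {s : ℝ} (hs : 0 < s) (z : Vec n) :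
    ‖z‖ ^ 2 * heatWeight m s z ≤ 8 * (s ^ (-(((n : ℝ) + 1) / 2)) * Real.exp (-(s * m ^ 2)) *
      Real.exp (-(1 / (8 * s)) * ‖z‖ ^ 2)) := by
  have h1 := Real.add_one_le_exp (‖z‖ ^ 2 / (8 * s))
  have h2 : ‖z‖ ^ 2 ≤ 8 * s * Real.exp (‖z‖ ^ 2 / (8 * s)) := by
    have : ‖z‖ ^ 2 = 8 * s * (‖z‖ ^ 2 / (8 * s)) := by field_simp
    nlinarith [Real.exp_pos (‖z‖ ^ 2 / (8 * s))]
  have h3 : s ^ (-(((n : ℝ) + 1) / 2)) = s * s ^ (-(((n : ℝ) + 1) / 2 + 1)) := by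
    nth_rewrite 2 [← Real.rpow_one s]
    rw [← Real.rpow_add hs]
    ring_nf
  calc ‖z‖ ^ 2 * heatWeight m s z
      ≤ 8 * s * Real.exp (‖z‖ ^ 2 / (8 * s)) * heatWeight m s z :=
        mul_le_mul_of_nonneg_right h2 (heatWeight_nonneg m hs z)
    _ = _ := by
        rw [heatWeight, h3]
        have : Real.exp (‖z‖ ^ 2 / (8 * s)) * Real.exp (-(s * m ^ 2) - ‖z‖ ^ 2 / (4 * s))
            = Real.exp (-(s * m ^ 2)) * Real.exp (-(1 / (8 * s)) * ‖z‖ ^ 2) := by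
          rw [← Real.exp_add, ← Real.exp_add]
          congr 1
          field_simp
          ring
        linear_combination (8 * s * s ^ (-(((n : ℝ) + 1) / 2 + 1))) * this

theorem integrable_rexp_neg_mul_sq_norm {n : ℕ} {b : ℝ} (hb : 0 < b) :
    Integrable fun z : Vec n => Real.exp (-b * ‖z‖ ^ 2) := by
  have h := (GaussianFourier.integrable_cexp_neg_mul_sq_norm_add (b := (b : ℂ))
    (by simpa using hb) 0 (0 : Vec n)).norm
  refine h.congr (ae_of_all _ fun z => ?_)
  simp only [Complex.norm_exp]
  congr 1
  have : (-(b : ℂ) * (‖z‖ : ℂ) ^ 2 + 0 * ((inner ℝ (0 : Vec n) z : ℝ) : ℂ))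
      = ((-b * ‖z‖ ^ 2 : ℝ) : ℂ) := by push_cast; ring
  rw [this, Complex.ofReal_re]

/-- Integrating the Gaussian majorant over `z` gives `s^{n/2}`, so `s^{-(n+1)/2}` becomes
`s^{-1/2}`, integrable at `0`; the factor `e^{-sm²}` with `m > 0` handles infinity. This is the
domination behind Fubini for the kernel. -/
theorem integrable_sq_norm_mul_heatWeight {n : ℕ} {m : ℝ} (hm : 0 < m) :
    Integrable (fun x : ℝ × Vec n => ‖x.2‖ ^ 2 * heatWeight m x.1 x.2)
      ((volume.restrict (Set.Ioi (0 : ℝ))).prod volume) := by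
  have hmeas : Measurable fun x : ℝ × Vec n =>
      8 * (x.1 ^ (-(((n : ℝ) + 1) / 2)) * Real.exp (-(x.1 * m ^ 2)) *
      Real.exp (-(1 / (8 * x.1)) * ‖x.2‖ ^ 2)) := by fun_prop
  have hdom : Integrable (fun x : ℝ × Vec n =>
      8 * (x.1 ^ (-(((n : ℝ) + 1) / 2)) * Real.exp (-(x.1 * m ^ 2)) *
      Real.exp (-(1 / (8 * x.1)) * ‖x.2‖ ^ 2)))
      ((volume.restrict (Set.Ioi (0 : ℝ))).prod volume) := by
    rw [integrable_prod_iff hmeas.aestronglyMeasurable]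
    constructor
    · refine (ae_restrict_iff' measurableSet_Ioi).2 (ae_of_all _ fun s hs => ?_)
      have hs : 0 < s := hs
      have hb : 0 < 1 / (8 * s) := by positivity
      exact ((integrable_rexp_neg_mul_sq_norm (n := n) hb).const_mul
        (s ^ (-(((n : ℝ) + 1) / 2)) * Real.exp (-(s * m ^ 2)))).const_mul 8
    · have hG : IntegrableOn (fun s : ℝ => (8 * (8 * Real.pi) ^ ((n : ℝ) / 2)) *
          (s ^ (-(1 / 2) : ℝ) * Real.exp (-(m ^ 2) * s ^ (1 : ℝ)))) (Set.Ioi 0) :=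
        (integrableOn_rpow_mul_exp_neg_mul_rpow (by norm_num) one_pos (by positivity)).const_mul _
      refine hG.congr_fun (fun s hs => ?_) measurableSet_Ioi
      have hs : 0 < s := hs
      have hnn : ∀ z : Vec n, ‖8 * (s ^ (-(((n : ℝ) + 1) / 2)) * Real.exp (-(s * m ^ 2)) *
          Real.exp (-(1 / (8 * s)) * ‖z‖ ^ 2))‖ = 8 * (s ^ (-(((n : ℝ) + 1) / 2)) *
          Real.exp (-(s * m ^ 2)) * Real.exp (-(1 / (8 * s)) * ‖z‖ ^ 2)) :=
        fun z => Real.norm_of_nonneg (by positivity)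
      simp only [hnn]
      rw [integral_const_mul, integral_const_mul,
        GaussianFourier.integral_rexp_neg_mul_sq_norm (by positivity)]
      have e1 : (Real.pi / (1 / (8 * s))) ^ ((Module.finrank ℝ (Vec n) : ℝ) / 2)
          = (8 * Real.pi) ^ ((n : ℝ) / 2) * s ^ ((n : ℝ) / 2) := by
        rw [finrank_euclideanSpace_fin, ← Real.mul_rpow (by positivity) hs.le]
        congr 1
        field_simp
      have e2 : s ^ (-(1 / 2) : ℝ) = s ^ (-(((n : ℝ) + 1) / 2)) * s ^ ((n : ℝ) / 2) := by
        rw [← Real.rpow_add hs]; ring_nf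
      rw [e1, e2, Real.rpow_one]
      ring_nf
  refine hdom.mono' ?_ ?_
  · exact (((measurable_snd.norm).pow_const 2).mul (measurable_heatWeight m)).aestronglyMeasurable
  · have : ∀ᵐ x : ℝ × Vec n ∂((volume.restrict (Set.Ioi (0 : ℝ))).prod volume), 0 < x.1 :=
      Measure.quasiMeasurePreserving_fst.ae (p := fun s : ℝ => 0 < s)
        ((ae_restrict_iff' measurableSet_Ioi).2 (ae_of_all _ fun s hs => hs))
    filter_upwards [this] with x hx
    rw [Real.norm_of_nonneg (mul_nonneg (by positivity) (heatWeight_nonneg m hx _))]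
    exact sq_norm_mul_heatWeight_le m hx x.2

theorem norm_mul_abs_velKernel_le {n : ℕ} {m : ℝ} (hm : 0 < m) (j : Fin n) (z : Vec n) :
    ‖z‖ * |velKernel m j z|
      ≤ velConst n * ∫ s in Set.Ioi (0 : ℝ), ‖z‖ ^ 2 * heatWeight m s z := by
  have h0 : 0 ≤ ∫ s in Set.Ioi (0 : ℝ), heatWeight m s z :=
    setIntegral_nonneg measurableSet_Ioi fun s hs => heatWeight_nonneg m hs z
  rw [velKernel_eq hm, integral_const_mul, abs_mul, abs_mul, abs_of_nonneg (velConst_nonneg n),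
    abs_of_nonneg h0]
  generalize (∫ s in Set.Ioi (0 : ℝ), heatWeight m s z) = w at h0 ⊢
  have h1 : |z j| ≤ ‖z‖ := by simpa using PiLp.norm_apply_le z j
  have h2 := velConst_nonneg n
  calc ‖z‖ * (velConst n * (|z j| * w)) = (velConst n * ‖z‖ * w) * |z j| := by ring
    _ ≤ (velConst n * ‖z‖ * w) * ‖z‖ := mul_le_mul_of_nonneg_left h1 (by positivity)
    _ = _ := by ring

/-- One factor `|z|` tames the singularity `|z|^{-n}`. This function dominates both the truncated
kernels and the sine transforms. -/
theorem integrable_norm_mul_velKernel {n : ℕ} {m : ℝ} (hm : 0 < m) (j : Fin n) :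
    Integrable fun z : Vec n => ‖z‖ * |velKernel m j z| := by
  refine ((integrable_sq_norm_mul_heatWeight (n := n) hm).integral_prod_right.const_mul
    (velConst n)).mono' ?_ (ae_of_all _ fun z => ?_)
  · exact (measurable_norm.mul (stronglyMeasurable_velKernel hm j).measurable.abs
      ).aestronglyMeasurable
  · rw [Real.norm_of_nonneg (by positivity)]
    exact norm_mul_abs_velKernel_le hm j z

/-! ### The sine transform of the velocity kernel -/

theorem abs_sin_inner_le {n : ℕ} (p z : Vec n) : |Real.sin (inner ℝ p z)| ≤ ‖p‖ * ‖z‖ :=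
  (Real.abs_sin_le_abs).trans (abs_real_inner_le_norm p z)

/-- The real part of the Gaussian Fourier transform. -/
theorem integral_rexp_neg_mul_sq_norm_mul_cos {n : ℕ} {b : ℝ} (hb : 0 < b) (p : Vec n) :
    ∫ z : Vec n, Real.exp (-b * ‖z‖ ^ 2) * Real.cos (inner ℝ p z)
      = (Real.pi / b) ^ ((n : ℝ) / 2) * Real.exp (-(‖p‖ ^ 2 / (4 * b))) := by
  have hb' : 0 < ((b : ℝ) : ℂ).re := by simpa using hb
  have h := GaussianFourier.integral_cexp_neg_mul_sq_norm_add hb' Complex.I p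
  have hi := GaussianFourier.integrable_cexp_neg_mul_sq_norm_add hb' Complex.I p
  have h2 := congrArg Complex.re h
  rw [← RCLike.re_eq_complex_re, ← integral_re hi] at h2
  have h3 : ∀ z : Vec n, RCLike.re (Complex.exp (-(b : ℂ) * (‖z‖ : ℂ) ^ 2
      + Complex.I * ((inner ℝ p z : ℝ) : ℂ)))
      = Real.exp (-b * ‖z‖ ^ 2) * Real.cos (inner ℝ p z) := by
    intro z
    rw [RCLike.re_eq_complex_re, Complex.exp_re]
    have : (-(b : ℂ) * (‖z‖ : ℂ) ^ 2 + Complex.I * ((inner ℝ p z : ℝ) : ℂ))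
      = ((-b * ‖z‖ ^ 2 : ℝ) : ℂ) + ((inner ℝ p z : ℝ) : ℂ) * Complex.I := by push_cast; ring
    rw [this, Complex.add_re, Complex.add_im, Complex.re_ofReal_mul, Complex.im_ofReal_mul,
      Complex.ofReal_re, Complex.ofReal_im, Complex.I_re, Complex.I_im, mul_zero, mul_one,
      add_zero, zero_add]
  simp only [h3] at h2
  rw [h2, RCLike.re_eq_complex_re]
  have h4 : ((Real.pi : ℂ) / (b : ℂ)) ^ ((Module.finrank ℝ (Vec n) : ℂ) / 2)
      * Complex.exp (Complex.I ^ 2 * (‖p‖ : ℂ) ^ 2 / (4 * (b : ℂ)))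
      = (((Real.pi / b) ^ ((n : ℝ) / 2) * Real.exp (-(‖p‖ ^ 2 / (4 * b))) : ℝ) : ℂ) := by
    rw [finrank_euclideanSpace_fin, Complex.I_sq, Complex.ofReal_mul,
      Complex.ofReal_cpow (by positivity)]
    push_cast
    ring_nf
  rw [h4, Complex.ofReal_re]

theorem integrable_norm_mul_rexp_neg_mul_sq_norm {n : ℕ} {b : ℝ} (hb : 0 < b) :
    Integrable fun z : Vec n => ‖z‖ * Real.exp (-b * ‖z‖ ^ 2) := by
  refine ((integrable_rexp_neg_mul_sq_norm (n := n) (half_pos hb)).const_mul (1 + 1 / b)).mono'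
    (by fun_prop) (ae_of_all _ fun z => ?_)
  rw [Real.norm_of_nonneg (by positivity)]
  have h1 := Real.add_one_le_exp (b / 2 * ‖z‖ ^ 2)
  have h2 : ‖z‖ ≤ (1 + 1 / b) * Real.exp (b / 2 * ‖z‖ ^ 2) := by
    have h3 : (1 + 1 / b) * (b / 2 * ‖z‖ ^ 2 + 1) ≤ (1 + 1 / b) * Real.exp (b / 2 * ‖z‖ ^ 2) :=
      mul_le_mul_of_nonneg_left h1 (by positivity)
    have h4 : (1 + 1 / b) * (b / 2 * ‖z‖ ^ 2 + 1)
        = b / 2 * ‖z‖ ^ 2 + 1 + ‖z‖ ^ 2 / 2 + 1 / b := by field_simp; ring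
    have : 0 ≤ b / 2 * ‖z‖ ^ 2 := by positivity
    have : 0 ≤ 1 / b := by positivity
    nlinarith [sq_nonneg (‖z‖ - 1)]
  calc ‖z‖ * Real.exp (-b * ‖z‖ ^ 2)
      ≤ (1 + 1 / b) * Real.exp (b / 2 * ‖z‖ ^ 2) * Real.exp (-b * ‖z‖ ^ 2) :=
        mul_le_mul_of_nonneg_right h2 (Real.exp_pos _).le
    _ = _ := by
        rw [mul_assoc, ← Real.exp_add]
        ring_nf

theorem abs_apply_le_norm {n : ℕ} (z : Vec n) (j : Fin n) : |z j| ≤ ‖z‖ := by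
  simpa using PiLp.norm_apply_le z j

/-- Since `z_j e^{-b|z|²} = -(1/2b) ∂_j e^{-b|z|²}`, integration by parts moves the derivative onto
the sine and leaves the cosine transform of a Gaussian. -/
theorem integral_coord_mul_sin_mul_gaussian {n : ℕ} {b : ℝ} (hb : 0 < b) (p : Vec n) (j : Fin n) :
    ∫ z : Vec n, z j * Real.sin (inner ℝ p z) * Real.exp (-b * ‖z‖ ^ 2)
      = p j / (2 * b) * ((Real.pi / b) ^ ((n : ℝ) / 2) * Real.exp (-(‖p‖ ^ 2 / (4 * b)))) := by
  set v : Vec n := EuclideanSpace.single j (1 : ℝ) with hv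
  have hf : ∀ z : Vec n, HasFDerivAt (fun z : Vec n => Real.sin (inner ℝ p z))
      (Real.cos (inner ℝ p z) • (innerSL ℝ p)) z := fun z =>
    (innerSL ℝ p).hasFDerivAt.sin
  have hg : ∀ z : Vec n, HasFDerivAt (fun z : Vec n => Real.exp (-b * ‖z‖ ^ 2))
      (Real.exp (-b * ‖z‖ ^ 2) • (-b) • (2 • (innerSL ℝ z))) z := fun z =>
    ((hasStrictFDerivAt_norm_sq z).hasFDerivAt.const_mul (-b)).exp
  have hf' : ∀ z : Vec n, fderiv ℝ (fun z : Vec n => Real.sin (inner ℝ p z)) z v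
      = p j * Real.cos (inner ℝ p z) := by
    intro z
    rw [(hf z).fderiv]
    simp [hv, EuclideanSpace.inner_single_right, mul_comm]
  have hg' : ∀ z : Vec n, fderiv ℝ (fun z : Vec n => Real.exp (-b * ‖z‖ ^ 2)) z v
      = -(2 * b) * (z j * Real.exp (-b * ‖z‖ ^ 2)) := by
    intro z
    rw [(hg z).fderiv]
    simp [hv, EuclideanSpace.inner_single_right]
    ring
  have hi0 := integrable_rexp_neg_mul_sq_norm (n := n) hb
  have hi1 : Integrable fun z : Vec n => Real.exp (-b * ‖z‖ ^ 2) * Real.cos (inner ℝ p z) := by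
    refine hi0.mono' (by fun_prop) (ae_of_all _ fun z => ?_)
    rw [norm_mul, Real.norm_of_nonneg (Real.exp_pos _).le]
    exact mul_le_of_le_one_right (Real.exp_pos _).le (Real.abs_cos_le_one _)
  have hi2 : Integrable fun z : Vec n => Real.sin (inner ℝ p z) * Real.exp (-b * ‖z‖ ^ 2) := by
    refine hi0.mono' (by fun_prop) (ae_of_all _ fun z => ?_)
    rw [norm_mul, Real.norm_of_nonneg (Real.exp_pos _).le]
    exact mul_le_of_le_one_left (Real.exp_pos _).le (Real.abs_sin_le_one _)
  have hi3 : Integrable fun z : Vec n =>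
      Real.sin (inner ℝ p z) * (-(2 * b) * (z j * Real.exp (-b * ‖z‖ ^ 2))) := by
    refine ((integrable_norm_mul_rexp_neg_mul_sq_norm (n := n) hb).const_mul (2 * b)).mono'
      (by fun_prop) (ae_of_all _ fun z => ?_)
    rw [norm_mul, norm_mul, norm_mul, norm_neg, Real.norm_of_nonneg (Real.exp_pos _).le,
      Real.norm_of_nonneg (by positivity : 0 ≤ 2 * b)]
    have h1 := abs_apply_le_norm z j
    refine (mul_le_of_le_one_left (by positivity) (Real.abs_sin_le_one _)).trans ?_
    gcongr
    exact h1
  have key := integral_mul_fderiv_eq_neg_fderiv_mul_of_integrable (μ := volume)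
    (f := fun z : Vec n => Real.sin (inner ℝ p z)) (g := fun z : Vec n => Real.exp (-b * ‖z‖ ^ 2))
    (v := v)
    (by
      simp only [hf']
      exact (hi1.const_mul (p j)).congr (ae_of_all _ fun z => by ring))
    (by simpa only [hg'] using hi3) hi2
    (fun z _ => (hf z).differentiableAt) (fun z _ => (hg z).differentiableAt)
  simp only [hf', hg'] at key
  have h1 : ∫ z : Vec n, Real.sin (inner ℝ p z) * (-(2 * b) * (z j * Real.exp (-b * ‖z‖ ^ 2)))
      = -(2 * b) * ∫ z : Vec n, z j * Real.sin (inner ℝ p z) * Real.exp (-b * ‖z‖ ^ 2) := by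
    rw [← integral_const_mul]
    exact integral_congr_ae (ae_of_all _ fun z => by ring)
  have h2 : ∫ z : Vec n, p j * Real.cos (inner ℝ p z) * Real.exp (-b * ‖z‖ ^ 2)
      = p j * ∫ z : Vec n, Real.exp (-b * ‖z‖ ^ 2) * Real.cos (inner ℝ p z) := by
    rw [← integral_const_mul]
    exact integral_congr_ae (ae_of_all _ fun z => by ring)
  rw [h1, h2, integral_rexp_neg_mul_sq_norm_mul_cos hb] at key
  rw [div_mul_eq_mul_div, eq_div_iff (by positivity)]
  linarith

/-- Fubini in `(s, z)` reduces this to Gaussians with `b = 1/4s`, whose transform is proportional to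
`e^{-s|p|²}`. Together with `e^{-sm²}` this is `e^{-sω²}`, the powers of `s` collapse to `s^{-1/2}`,
and `Γ(1/2) = √π` produces `1/ω`. -/
theorem integral_velKernel_mul_sin {n : ℕ} {m : ℝ} (hm : 0 < m) (j : Fin n) (p : Vec n) :
    ∫ z : Vec n, velKernel m j z * Real.sin (inner ℝ p z) = p j / energy m p := by
  have hF : Integrable (fun x : ℝ × Vec n =>
      x.2 j * Real.sin (inner ℝ p x.2) * heatWeight m x.1 x.2)
      ((volume.restrict (Set.Ioi (0 : ℝ))).prod volume) := by
    refine ((integrable_sq_norm_mul_heatWeight (n := n) hm).norm.const_mul ‖p‖).mono' ?_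
      (ae_of_all _ fun x => ?_)
    · have := measurable_heatWeight (n := n) m
      exact Measurable.aestronglyMeasurable (by fun_prop)
    · rw [norm_mul, norm_mul, norm_mul, Real.norm_of_nonneg (by positivity : 0 ≤ ‖x.2‖ ^ 2)]
      have h1 := abs_apply_le_norm x.2 j
      have h2 := abs_sin_inner_le p x.2
      calc ‖x.2 j‖ * ‖Real.sin (inner ℝ p x.2)‖ * ‖heatWeight m x.1 x.2‖
          ≤ ‖x.2‖ * (‖p‖ * ‖x.2‖) * ‖heatWeight m x.1 x.2‖ := by gcongr; exact h1; exact h2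
        _ = _ := by ring
  have h1 : ∫ z : Vec n, velKernel m j z * Real.sin (inner ℝ p z)
      = velConst n * ∫ z : Vec n, ∫ s in Set.Ioi (0 : ℝ),
        z j * Real.sin (inner ℝ p z) * heatWeight m s z := by
    rw [← integral_const_mul]
    refine integral_congr_ae (ae_of_all _ fun z => ?_)
    simp only [velKernel_eq hm]
    rw [integral_const_mul]
    ring
  rw [h1, ← integral_integral_swap hF]
  have hE : 0 < energy m p := energy_pos hm p
  have hE2 : energy m p ^ 2 = ‖p‖ ^ 2 + m ^ 2 := Real.sq_sqrt (by positivity)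
  have h2 : ∀ s ∈ Set.Ioi (0 : ℝ),
      (∫ z : Vec n, z j * Real.sin (inner ℝ p z) * heatWeight m s z)
      = (2 * p j * (4 * Real.pi) ^ ((n : ℝ) / 2)) *
        (s ^ ((1 / 2 : ℝ) - 1) * Real.exp (-(energy m p ^ 2 * s))) := by
    intro s hs
    have hs : 0 < s := hs
    have hb : 0 < 1 / (4 * s) := by positivity
    have h3 : ∀ z : Vec n, z j * Real.sin (inner ℝ p z) * heatWeight m s z
        = (s ^ (-(((n : ℝ) + 1) / 2 + 1)) * Real.exp (-(s * m ^ 2))) *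
          (z j * Real.sin (inner ℝ p z) * Real.exp (-(1 / (4 * s)) * ‖z‖ ^ 2)) := by
      intro z
      have : Real.exp (-(s * m ^ 2) - ‖z‖ ^ 2 / (4 * s))
          = Real.exp (-(s * m ^ 2)) * Real.exp (-(1 / (4 * s)) * ‖z‖ ^ 2) := by
        rw [← Real.exp_add]; congr 1; ring
      rw [heatWeight, this]
      ring
    simp only [h3]
    rw [integral_const_mul, integral_coord_mul_sin_mul_gaussian hb]
    have e1 : (Real.pi / (1 / (4 * s))) ^ ((n : ℝ) / 2)
        = (4 * Real.pi) ^ ((n : ℝ) / 2) * s ^ ((n : ℝ) / 2) := by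
      rw [← Real.mul_rpow (by positivity) hs.le]
      congr 1
      field_simp
    have e2 : s ^ ((1 / 2 : ℝ) - 1) = s ^ (-(((n : ℝ) + 1) / 2 + 1)) * s ^ ((n : ℝ) / 2) * s := by
      nth_rewrite 4 [← Real.rpow_one s]
      rw [← Real.rpow_add hs, ← Real.rpow_add hs]
      ring_nf
    have e3 : Real.exp (-(energy m p ^ 2 * s))
        = Real.exp (-(s * m ^ 2)) * Real.exp (-(‖p‖ ^ 2 / (4 * (1 / (4 * s))))) := by
      rw [← Real.exp_add, hE2]
      congr 1
      field_simp
      ring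
    rw [e1, e2, e3]
    field_simp
    ring
  rw [setIntegral_congr_fun measurableSet_Ioi h2, integral_const_mul,
    Real.integral_rpow_mul_exp_neg_mul_Ioi (by norm_num) (by positivity),
    Real.Gamma_one_half_eq, velConst, ← Real.sqrt_eq_rpow, one_div, Real.sqrt_inv,
    Real.sqrt_sq hE.le, Real.rpow_neg (by positivity)]
  have : (4 * Real.pi) ^ ((n : ℝ) / 2) ≠ 0 := by positivity
  have : Real.sqrt Real.pi ≠ 0 := by positivity
  field_simp

/-! ### The principal value convolution with the velocity kernel -/

theorem contr_eq_neg_inner {n : ℕ} (p x : Vec n) : contr p x = -inner ℝ p x := by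
  simp [contr, lowerIdx, PiLp.inner_apply, mul_comm]

/-- The plane wave `e^{-i p_k x^k}`. -/
noncomputable def planeWave {n : ℕ} (p x : Vec n) : ℂ := Complex.exp (-(Complex.I * (contr p x : ℂ)))

theorem planeWave_eq {n : ℕ} (p x : Vec n) :
    planeWave p x = Complex.exp (((inner ℝ p x : ℝ) : ℂ) * Complex.I) := by
  rw [planeWave, contr_eq_neg_inner]
  push_cast
  ring_nf

theorem norm_planeWave {n : ℕ} (p x : Vec n) : ‖planeWave p x‖ = 1 := by
  rw [planeWave_eq, Complex.norm_exp_ofReal_mul_I]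

theorem continuous_planeWave {n : ℕ} : Continuous fun y : Vec n × Vec n => planeWave y.1 y.2 := by
  simp only [planeWave_eq]
  fun_prop

theorem planeWave_sub {n : ℕ} (p x z : Vec n) :
    planeWave p (x - z) = planeWave p x *
      (((Real.cos (inner ℝ p z) : ℝ) : ℂ) - Complex.I * ((Real.sin (inner ℝ p z) : ℝ) : ℂ)) := by
  have : ((inner ℝ p (x - z) : ℝ) : ℂ) * Complex.I
      = ((inner ℝ p x : ℝ) : ℂ) * Complex.I + ((-inner ℝ p z : ℝ) : ℂ) * Complex.I := by
    rw [inner_sub_right]; push_cast; ring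
  rw [planeWave_eq, planeWave_eq, this, Complex.exp_add, Complex.exp_mul_I ((-inner ℝ p z : ℝ) : ℂ),
    ← Complex.ofReal_cos, ← Complex.ofReal_sin, Real.cos_neg, Real.sin_neg]
  push_cast
  ring

/-- The velocity kernel with the ball of radius `ε` removed. -/
noncomputable def truncKernel {n : ℕ} (m : ℝ) (j : Fin n) (ε : ℝ) (z : Vec n) : ℝ :=
  {z : Vec n | ε < ‖z‖}.indicator (velKernel m j) z

theorem measurableSet_norm_gt {n : ℕ} (ε : ℝ) : MeasurableSet {z : Vec n | ε < ‖z‖} :=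
  measurableSet_lt measurable_const measurable_norm

theorem measurable_truncKernel {n : ℕ} {m : ℝ} (hm : 0 < m) (j : Fin n) (ε : ℝ) :
    Measurable (truncKernel (n := n) m j ε) :=
  (stronglyMeasurable_velKernel hm j).measurable.indicator (measurableSet_norm_gt ε)

theorem abs_truncKernel_le {n : ℕ} (m : ℝ) (j : Fin n) (ε : ℝ) (z : Vec n) :
    |truncKernel m j ε z| ≤ |velKernel m j z| := by
  unfold truncKernel
  by_cases h : z ∈ {z : Vec n | ε < ‖z‖} <;> simp [h]

/-- Outside the ball, `1 ≤ |z|/ε`. -/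
theorem integrable_truncKernel {n : ℕ} {m : ℝ} (hm : 0 < m) (j : Fin n) {ε : ℝ} (hε : 0 < ε) :
    Integrable (truncKernel (n := n) m j ε) := by
  refine ((integrable_norm_mul_velKernel hm j).const_mul ε⁻¹).mono'
    (measurable_truncKernel hm j ε).aestronglyMeasurable (ae_of_all _ fun z => ?_)
  by_cases h : z ∈ {z : Vec n | ε < ‖z‖}
  · have h' : ε < ‖z‖ := h
    rw [truncKernel, Set.indicator_of_mem h, Real.norm_eq_abs, inv_mul_eq_div, le_div_iff₀ hε,
      mul_comm]
    gcongr
  · rw [truncKernel, Set.indicator_of_notMem h]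
    simp only [norm_zero]
    positivity

theorem truncKernel_neg {n : ℕ} (m : ℝ) (j : Fin n) (ε : ℝ) (z : Vec n) :
    truncKernel m j ε (-z) = -truncKernel m j ε z := by
  unfold truncKernel
  by_cases h : ε < ‖z‖ <;> simp [Set.indicator, h, velKernel_neg]

theorem abs_truncKernel_mul_sin_le {n : ℕ} (m : ℝ) (j : Fin n) (ε : ℝ) (p z : Vec n) :
    |truncKernel m j ε z * Real.sin (inner ℝ p z)| ≤ ‖p‖ * (‖z‖ * |velKernel m j z|) := by
  rw [abs_mul]
  calc |truncKernel m j ε z| * |Real.sin (inner ℝ p z)| ≤ |velKernel m j z| * (‖p‖ * ‖z‖) :=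
        mul_le_mul (abs_truncKernel_le m j ε z) (abs_sin_inner_le p z) (abs_nonneg _)
          (abs_nonneg _)
    _ = _ := by ring

theorem abs_integral_truncKernel_mul_sin_le {n : ℕ} {m : ℝ} (hm : 0 < m) (j : Fin n) (ε : ℝ)
    (p : Vec n) : |∫ z, truncKernel m j ε z * Real.sin (inner ℝ p z)|
      ≤ ‖p‖ * ∫ z : Vec n, ‖z‖ * |velKernel m j z| := by
  rw [← integral_const_mul]
  exact norm_integral_le_of_norm_le
    (f := fun z => truncKernel m j ε z * Real.sin (inner ℝ p z)) ((integrable_norm_mul_velKernel hm j).const_mul _)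
    (ae_of_all _ fun z => abs_truncKernel_mul_sin_le m j ε p z)

theorem tendsto_integral_truncKernel_mul_sin {n : ℕ} {m : ℝ} (hm : 0 < m) (j : Fin n)
    (p : Vec n) :
    Tendsto (fun ε => ∫ z, truncKernel m j ε z * Real.sin (inner ℝ p z)) (𝓝[>] (0 : ℝ))
      (𝓝 (p j / energy m p)) := by
  rw [← integral_velKernel_mul_sin hm]
  refine tendsto_integral_filter_of_dominated_convergence
    (fun z => ‖p‖ * (‖z‖ * |velKernel m j z|)) (Eventually.of_forall fun ε => ?_)
    (Eventually.of_forall fun ε => ae_of_all _ fun z => abs_truncKernel_mul_sin_le m j ε p z)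
    ((integrable_norm_mul_velKernel hm j).const_mul _) (ae_of_all _ fun z => ?_)
  · have := measurable_truncKernel hm j ε
    exact Measurable.aestronglyMeasurable (by fun_prop)
  · rcases eq_or_ne z 0 with rfl | hz
    -- At `z = 0` the sine vanishes; at any other point the truncation has no effect once `ε < |z|`.
    · simp
    · refine tendsto_const_nhds.congr' ?_
      have hz' : 0 < ‖z‖ := norm_pos_iff.2 hz
      filter_upwards [mem_nhdsWithin_of_mem_nhds (Iio_mem_nhds hz')] with ε hε
      rw [truncKernel, Set.indicator_of_mem (show z ∈ {z : Vec n | ε < ‖z‖} from hε)]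

/-- The integrand is odd; reflection invariance of the integral gives zero without any
integrability. -/
theorem integral_truncKernel_mul_cos {n : ℕ} (m : ℝ) (j : Fin n) (ε : ℝ) (p : Vec n) :
    ∫ z, truncKernel m j ε z * Real.cos (inner ℝ p z) = 0 := by
  have h := integral_neg_eq_self (fun z => truncKernel m j ε z * Real.cos (inner ℝ p z)) volume
  simp only [truncKernel_neg, inner_neg_right, Real.cos_neg, neg_mul, integral_neg] at h
  linarith

/-- Plane waves diagonalize the truncated convolution, and oddness leaves only the sine part of the
multiplier. -/
theorem integral_truncKernel_mul_planeWave_sub {n : ℕ} {m : ℝ} (hm : 0 < m) (j : Fin n) {ε : ℝ}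
    (hε : 0 < ε) (p x : Vec n) :
    ∫ z, (truncKernel m j ε z : ℂ) * planeWave p (x - z)
      = planeWave p x * (-Complex.I *
        ((∫ z, truncKernel m j ε z * Real.sin (inner ℝ p z) : ℝ) : ℂ)) := by
  have hi := integrable_truncKernel hm j hε
  have hc : Integrable fun z => truncKernel m j ε z * Real.cos (inner ℝ p z) :=
    hi.mul_bdd (c := 1) (by fun_prop) (ae_of_all _ fun z => Real.abs_cos_le_one _)
  have hs : Integrable fun z => truncKernel m j ε z * Real.sin (inner ℝ p z) :=
    hi.mul_bdd (c := 1) (by fun_prop) (ae_of_all _ fun z => Real.abs_sin_le_one _)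
  have h : ∀ z, (truncKernel m j ε z : ℂ) * planeWave p (x - z)
      = planeWave p x * (((truncKernel m j ε z * Real.cos (inner ℝ p z) : ℝ) : ℂ)
        - Complex.I * ((truncKernel m j ε z * Real.sin (inner ℝ p z) : ℝ) : ℂ)) := by
    intro z
    rw [planeWave_sub]
    push_cast
    ring
  simp only [h]
  rw [integral_const_mul, integral_sub hc.ofReal (hs.ofReal.const_mul _), integral_const_mul,
    integral_complex_ofReal, integral_complex_ofReal, integral_truncKernel_mul_cos]
  simp

/-- The superposition `x ↦ ∫ dp e^{-i p_k x^k} g(p)` of plane waves. -/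
noncomputable def waveSum {n : ℕ} (g : Vec n → ℂ) (x : Vec n) : ℂ := ∫ p, planeWave p x * g p

theorem integrable_planeWave_mul {n : ℕ} {g : Vec n → ℂ} (hg : Integrable g) (x : Vec n) :
    Integrable fun p => planeWave p x * g p :=
  hg.bdd_mul (c := 1)
    (continuous_planeWave.comp (Continuous.prodMk_left x)).aestronglyMeasurable
    (ae_of_all _ fun p => (norm_planeWave p x).le)

theorem norm_waveSum_le {n : ℕ} (g : Vec n → ℂ) (x : Vec n) : ‖waveSum g x‖ ≤ ∫ p, ‖g p‖ := by
  refine (norm_integral_le_integral_norm _).trans_eq ?_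
  simp [norm_planeWave]

theorem continuous_waveSum {n : ℕ} {g : Vec n → ℂ} (hg : Integrable g) :
    Continuous (waveSum g) := by
  refine continuous_of_dominated (bound := fun p => ‖g p‖)
    (fun x => (integrable_planeWave_mul hg x).aestronglyMeasurable)
    (fun x => ae_of_all _ fun p => ?_) hg.norm (ae_of_all _ fun p => ?_)
  · simp [norm_planeWave]
  · exact (continuous_planeWave.comp (Continuous.prodMk_right p)).mul continuous_const

theorem indicator_velKernel_sub_mul {n : ℕ} (m : ℝ) (j : Fin n) (ε : ℝ) (x y : Vec n)
    (f : Vec n → ℂ) :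
    {y : Vec n | ε < ‖x - y‖}.indicator (fun y => (velKernel m j (x - y) : ℂ) * f y) y
      = (truncKernel m j ε (x - y) : ℂ) * f y := by
  unfold truncKernel
  by_cases h : ε < ‖x - y‖ <;> simp [Set.indicator, h]

theorem measurableSet_norm_sub_gt {n : ℕ} (ε : ℝ) (x : Vec n) :
    MeasurableSet {y : Vec n | ε < ‖x - y‖} :=
  measurableSet_lt measurable_const (by fun_prop)

theorem integrableOn_velKernel_mul_waveSum {n : ℕ} {m : ℝ} (hm : 0 < m) (j : Fin n) {ε : ℝ}
    (hε : 0 < ε) {g : Vec n → ℂ} (hg : Integrable g) (x : Vec n) :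
    IntegrableOn (fun y => (velKernel m j (x - y) : ℂ) * waveSum g y)
      {y : Vec n | ε < ‖x - y‖} := by
  rw [← integrable_indicator_iff (measurableSet_norm_sub_gt ε x)]
  refine Integrable.congr (f := fun y => (truncKernel m j ε (x - y) : ℂ) * waveSum g y) ?_
    (ae_of_all _ fun y => (indicator_velKernel_sub_mul m j ε x y _).symm)
  exact ((integrable_truncKernel hm j hε).comp_sub_left x).ofReal.mul_bdd (c := ∫ p, ‖g p‖)
    (continuous_waveSum hg).aestronglyMeasurable (ae_of_all _ fun y => norm_waveSum_le g y)

/-- For fixed `ε > 0` the truncated kernel and `g` are both integrable, so Fubini applies and each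
plane wave is multiplied by its eigenvalue. -/
theorem setIntegral_velKernel_mul_waveSum {n : ℕ} {m : ℝ} (hm : 0 < m) (j : Fin n) {ε : ℝ}
    (hε : 0 < ε) {g : Vec n → ℂ} (hg : Integrable g) (x : Vec n) :
    ∫ y in {y : Vec n | ε < ‖x - y‖}, (velKernel m j (x - y) : ℂ) * waveSum g y
      = ∫ p, planeWave p x * (-Complex.I *
        ((∫ z, truncKernel m j ε z * Real.sin (inner ℝ p z) : ℝ) : ℂ)) * g p := by
  rw [← integral_indicator (measurableSet_norm_sub_gt ε x)]
  simp only [indicator_velKernel_sub_mul]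
  have h1 := integral_sub_left_eq_self
    (fun z => (truncKernel m j ε z : ℂ) * waveSum g (x - z)) volume x
  simp only [sub_sub_cancel] at h1
  rw [h1]
  have hF : Integrable (fun y : Vec n × Vec n =>
      (truncKernel m j ε y.1 : ℂ) * (planeWave y.2 (x - y.1) * g y.2)) (volume.prod volume) := by
    have h2 : Integrable (fun y : Vec n × Vec n => planeWave y.2 (x - y.1) *
        ((truncKernel m j ε y.1 : ℂ) * g y.2)) (volume.prod volume) :=
      ((integrable_truncKernel hm j hε).ofReal.mul_prod hg).bdd_mul (c := 1)
        (continuous_planeWave.comp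
          (continuous_snd.prodMk (continuous_const.sub continuous_fst))).aestronglyMeasurable
        (ae_of_all _ fun y => (norm_planeWave _ _).le)
    exact h2.congr (ae_of_all _ fun y => by ring)
  calc ∫ z, (truncKernel m j ε z : ℂ) * waveSum g (x - z)
      = ∫ z, ∫ p, (truncKernel m j ε z : ℂ) * (planeWave p (x - z) * g p) := by
        simp only [integral_const_mul, waveSum]
    _ = ∫ p, ∫ z, (truncKernel m j ε z : ℂ) * (planeWave p (x - z) * g p) :=
        integral_integral_swap hF
    _ = _ := by
        refine integral_congr_ae (ae_of_all _ fun p => ?_)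
        simp only [← mul_assoc]
        rw [integral_mul_const, integral_truncKernel_mul_planeWave_sub hm j hε]
        ring

/-- The multipliers are at most `C|p|` uniformly in `ε`, so one finite moment of `g` justifies
dominated convergence. The limit `-i p^j/ω` equals `i p_j/ω` because lowering the index changes the
sign. -/
theorem tendsto_setIntegral_velKernel_mul_waveSum {n : ℕ} {m : ℝ} (hm : 0 < m) (j : Fin n)
    {g : Vec n → ℂ} (hg : Integrable g) (hg1 : Integrable fun p => ‖p‖ * ‖g p‖) (x : Vec n) :
    Tendsto (fun ε => ∫ y in {y : Vec n | ε < ‖x - y‖}, (velKernel m j (x - y) : ℂ) * waveSum g y)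
      (𝓝[>] (0 : ℝ))
      (𝓝 (waveSum (fun p => Complex.I * ((lowerIdx p j / energy m p : ℝ) : ℂ) * g p) x)) := by
  have h := tendsto_integral_filter_of_dominated_convergence (μ := volume) (l := 𝓝[>] (0 : ℝ))
    (F := fun ε p => planeWave p x * (-Complex.I *
        ((∫ z, truncKernel m j ε z * Real.sin (inner ℝ p z) : ℝ) : ℂ)) * g p)
    (f := fun p => planeWave p x * (-Complex.I * ((p j / energy m p : ℝ) : ℂ)) * g p)
    (fun p => (∫ z : Vec n, ‖z‖ * |velKernel m j z|) * (‖p‖ * ‖g p‖))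
    (Eventually.of_forall fun ε => ?_)
    (Eventually.of_forall fun ε => ae_of_all _ fun p => ?_)
    (hg1.const_mul _) (ae_of_all _ fun p => ?_)
  · have e : waveSum (fun p => Complex.I * ((lowerIdx p j / energy m p : ℝ) : ℂ) * g p) x
        = ∫ p, planeWave p x * (-Complex.I * ((p j / energy m p : ℝ) : ℂ)) * g p := by
      refine integral_congr_ae (ae_of_all _ fun p => ?_)
      simp only [lowerIdx]
      push_cast
      ring
    rw [e]
    refine h.congr' ?_
    filter_upwards [self_mem_nhdsWithin] with ε hε
    exact (setIntegral_velKernel_mul_waveSum hm j hε hg x).symm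
  · have h1 : StronglyMeasurable fun p : Vec n =>
        ∫ z, truncKernel m j ε z * Real.sin (inner ℝ p z) := by
      refine StronglyMeasurable.integral_prod_right'
        (f := fun y : Vec n × Vec n => truncKernel m j ε y.2 * Real.sin (inner ℝ y.1 y.2)) ?_
      have := measurable_truncKernel hm j ε
      exact Measurable.stronglyMeasurable (by fun_prop)
    have h2 : AEStronglyMeasurable (fun p : Vec n => planeWave p x) volume :=
      (continuous_planeWave.comp (Continuous.prodMk_left x)).aestronglyMeasurable
    exact (h2.mul ((Complex.continuous_ofReal.comp_stronglyMeasurable h1).const_mul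
      _).aestronglyMeasurable).mul hg.aestronglyMeasurable
  · rw [norm_mul, norm_mul, norm_mul, norm_planeWave, norm_neg, Complex.norm_I,
      Complex.norm_real, one_mul, one_mul]
    calc _ ≤ (‖p‖ * ∫ z : Vec n, ‖z‖ * |velKernel m j z|) * ‖g p‖ := by
          gcongr; exact abs_integral_truncKernel_mul_sin_le hm j ε p
      _ = _ := by ring
  · refine (Tendsto.const_mul _ (Tendsto.const_mul _ ?_)).mul_const _
    exact (Complex.continuous_ofReal.tendsto _).comp (tendsto_integral_truncKernel_mul_sin hm j p)

/-! ### Fourier inversion and the Plancherel formula for superpositions of plane waves -/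

/-- The convention of `𝓕⁻` has `2π` in the exponent, hence the dilation by `(2π)⁻¹`; its Jacobian is
the `(2π)^n` in the formulas below. -/
theorem waveSum_eq_fourierInv {n : ℕ} (g : Vec n → ℂ) (x : Vec n) :
    waveSum g x = 𝓕⁻ g ((2 * Real.pi)⁻¹ • x) := by
  rw [Real.fourierInv_eq', waveSum]
  refine integral_congr_ae (ae_of_all _ fun p => ?_)
  have : 2 * Real.pi * inner ℝ p ((2 * Real.pi)⁻¹ • x) = inner ℝ p x := by
    rw [inner_smul_right]
    have := Real.pi_pos
    field_simp
  simp only [this, planeWave_eq, smul_eq_mul]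

theorem waveSum_schwartz {n : ℕ} (g : 𝓢(Vec n, ℂ)) (x : Vec n) :
    waveSum g x = (𝓕⁻ g) ((2 * Real.pi)⁻¹ • x) := by
  rw [waveSum_eq_fourierInv, SchwartzMap.fourierInv_coe]

theorem integrable_waveSum {n : ℕ} (g : 𝓢(Vec n, ℂ)) : Integrable (waveSum g) := by
  have h := ((𝓕⁻ g).integrable (μ := volume)).comp_smul
    (R := (2 * Real.pi)⁻¹) (by positivity)
  exact h.congr (ae_of_all _ fun x => (waveSum_schwartz g x).symm)

theorem integral_comp_inv_two_pi_smul {n : ℕ} (F : Vec n → ℂ) :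
    ∫ x, F ((2 * Real.pi)⁻¹ • x) = ((2 * Real.pi) ^ n : ℝ) * ∫ y, F y := by
  rw [Measure.integral_comp_smul, finrank_euclideanSpace_fin, inv_pow, inv_inv,
    abs_of_pos (by positivity), Complex.real_smul]

theorem integral_conj_planeWave_mul_waveSum {n : ℕ} (g : 𝓢(Vec n, ℂ)) (p : Vec n) :
    ∫ x, conj (planeWave p x) * waveSum g x = ((2 * Real.pi) ^ n : ℝ) * g p := by
  have h : ∀ x, conj (planeWave p x) * waveSum g x
      = (fun y => Complex.exp (((-2 * Real.pi * inner ℝ y p : ℝ) : ℂ) * Complex.I) • (𝓕⁻ g) y)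
        ((2 * Real.pi)⁻¹ • x) := by
    intro x
    have : -2 * Real.pi * inner ℝ ((2 * Real.pi)⁻¹ • x) p = -inner ℝ p x := by
      rw [real_inner_smul_left, real_inner_comm]
      have := Real.pi_pos
      field_simp
    simp only [this, waveSum_schwartz, planeWave_eq, ← Complex.exp_conj, map_mul, Complex.conj_I,
      Complex.conj_ofReal, smul_eq_mul]
    push_cast
    ring_nf
  refine (integral_congr_ae (ae_of_all _ h)).trans ((integral_comp_inv_two_pi_smul (fun y =>
    Complex.exp (((-2 * Real.pi * inner ℝ y p : ℝ) : ℂ) * Complex.I) • (𝓕⁻ g) y)).trans ?_)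
  rw [← Real.fourier_eq', ← SchwartzMap.fourier_coe]
  simp

theorem integral_conj_waveSum_mul_waveSum {n : ℕ} (f g : 𝓢(Vec n, ℂ)) :
    ∫ x, conj (waveSum f x) * waveSum g x = ((2 * Real.pi) ^ n : ℝ) * ∫ p, conj (f p) * g p := by
  have h : ∀ x, conj (waveSum f x) * waveSum g x
      = (fun y => conj ((𝓕⁻ f) y) * (𝓕⁻ g) y) ((2 * Real.pi)⁻¹ • x) := by
    intro x
    simp only [waveSum_schwartz]
  refine (integral_congr_ae (ae_of_all _ h)).trans
    ((integral_comp_inv_two_pi_smul (fun y => conj ((𝓕⁻ f) y) * (𝓕⁻ g) y)).trans ?_)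
  have := SchwartzMap.integral_inner_fourier_fourier (𝓕⁻ f) (𝓕⁻ g)
  simp only [FourierTransform.fourier_fourierInv_eq] at this
  simp only [RCLike.inner_apply] at this
  simp only [mul_comm (conj _)]
  rw [← this]

/-! ### Temperate growth of functions of the energy -/

/-- Rescaling `p` by `m⁻¹` reduces powers of the energy to powers of `1 + |p|²`, known to have
temperate growth. -/
theorem energy_eq_rpow {n : ℕ} {m : ℝ} (hm : 0 < m) (p : Vec n) :
    energy m p = m * (1 + ‖m⁻¹ • p‖ ^ 2) ^ (1 / 2 : ℝ) := by
  rw [energy, ← Real.sqrt_eq_rpow, norm_smul, Real.norm_of_nonneg (by positivity)]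
  conv_rhs => rw [← Real.sqrt_sq hm.le]
  rw [← Real.sqrt_mul (by positivity), Real.sqrt_sq hm.le]
  congr 1
  field_simp
  ring

theorem hasTemperateGrowth_energy_rpow {n : ℕ} {m : ℝ} (hm : 0 < m) (r : ℝ) :
    Function.HasTemperateGrowth fun p : Vec n => energy m p ^ r := by
  have h : (fun p : Vec n => energy m p ^ r)
      = fun p => m ^ r * (1 + ‖m⁻¹ • p‖ ^ 2) ^ (1 / 2 * r : ℝ) := by
    funext p
    rw [energy_eq_rpow hm, Real.mul_rpow hm.le (by positivity), ← Real.rpow_mul (by positivity)]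
  rw [h]
  have h1 := (Function.hasTemperateGrowth_one_add_norm_sq_rpow (Vec n) (1 / 2 * r)).comp
    (m⁻¹ • ContinuousLinearMap.id ℝ (Vec n)).hasTemperateGrowth
  exact (Function.HasTemperateGrowth.const (m ^ r)).mul h1

theorem hasTemperateGrowth_apply {n : ℕ} (j : Fin n) :
    Function.HasTemperateGrowth fun p : Vec n => p j :=
  (EuclideanSpace.proj (𝕜 := ℝ) j : Vec n →L[ℝ] ℝ).hasTemperateGrowth

theorem hasTemperateGrowth_velocity {n : ℕ} {m : ℝ} (hm : 0 < m) (j : Fin n) :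
    Function.HasTemperateGrowth fun p : Vec n => ((lowerIdx p j / energy m p : ℝ) : ℂ) := by
  refine Function.HasTemperateGrowth.comp Function.Complex.hasTemperateGrowth_ofReal ?_
  have h := (hasTemperateGrowth_apply j).neg.mul (hasTemperateGrowth_energy_rpow hm (-1))
  convert! h using 2 with p
  simp [lowerIdx, Real.rpow_neg_one, div_eq_mul_inv]

theorem hasTemperateGrowth_sqrt_energy_inv {n : ℕ} {m : ℝ} (hm : 0 < m) :
    Function.HasTemperateGrowth fun p : Vec n => ((Real.sqrt (2 * energy m p))⁻¹ : ℂ) := by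
  have h := Function.HasTemperateGrowth.comp Function.Complex.hasTemperateGrowth_ofReal ((Function.HasTemperateGrowth.const
    (E := Vec n) ((2 : ℝ) ^ (-(1 / 2) : ℝ))).mul (hasTemperateGrowth_energy_rpow hm (-(1 / 2))))
  convert! h using 2 with p
  simp only [Function.comp]
  rw [← Complex.ofReal_inv, Real.sqrt_eq_rpow, ← Real.rpow_neg (by have := energy_pos hm p; positivity),
    Real.mul_rpow (by norm_num) (energy_pos hm p).le]
  rfl

/-! ### One-particle sections of Fock space vectors -/

theorem hasTemperateGrowth_finCons {n k : ℕ} (q : Fin k → Vec n) :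
    Function.HasTemperateGrowth fun p : Vec n => (Fin.cons p q : Fin (k + 1) → Vec n) := by
  have h : (fun p : Vec n => (Fin.cons p q : Fin (k + 1) → Vec n))
      = fun p => ContinuousLinearMap.single ℝ (fun _ : Fin (k + 1) => Vec n) 0 p
        + (Fin.cons 0 q : Fin (k + 1) → Vec n) := by
    funext p i
    refine Fin.cases ?_ (fun i => ?_) i <;> simp
  rw [h]
  exact (ContinuousLinearMap.hasTemperateGrowth _).add (Function.HasTemperateGrowth.const _)

/-- The section `p ↦ (p, q)` does not contract distances, so a Schwartz function restricted to it
still decays rapidly. -/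
theorem antilipschitz_finCons {n k : ℕ} (q : Fin k → Vec n) :
    AntilipschitzWith 1 fun p : Vec n => (Fin.cons p q : Fin (k + 1) → Vec n) := by
  refine AntilipschitzWith.of_le_mul_dist fun p p' => ?_
  have := dist_le_pi_dist (Fin.cons p q : Fin (k + 1) → Vec n) (Fin.cons p' q) 0
  simpa using this

theorem IsSchwartzFock.exists_schwartz_section {n : ℕ} {Ψ : WaveSeq n} (hΨ : IsSchwartzFock Ψ)
    {k : ℕ} (q : Fin k → Vec n) : ∃ f : 𝓢(Vec n, ℂ), ∀ p, Ψ (k + 1) (Fin.cons p q) = f p := by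
  obtain ⟨f, hf⟩ := hΨ.schwartz (k + 1)
  exact ⟨SchwartzMap.compCLMOfAntilipschitz ℝ (hasTemperateGrowth_finCons q)
    (antilipschitz_finCons q) f, fun p => hf _⟩

theorem IsSchwartzFock.exists_schwartz_ann {n : ℕ} {m : ℝ} (hm : 0 < m) {Ψ : WaveSeq n}
    (hΨ : IsSchwartzFock Ψ) {k : ℕ} (q : Fin k → Vec n) :
    ∃ f : 𝓢(Vec n, ℂ), ∀ p, ann m p Ψ k q = f p := by
  obtain ⟨f, hf⟩ := hΨ.exists_schwartz_section q
  refine ⟨SchwartzMap.smulLeftCLM ℂ (fun p : Vec n => ((Real.sqrt (2 * energy m p))⁻¹ : ℂ))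
    ((Real.sqrt (k + 1) : ℂ) • f), fun p => ?_⟩
  rw [SchwartzMap.smulLeftCLM_apply_apply (hasTemperateGrowth_sqrt_energy_inv hm)]
  simp [ann, annCov, hf]

theorem exists_schwartz_velocity_mul {n : ℕ} {m : ℝ} (hm : 0 < m) (j : Fin n) (f : 𝓢(Vec n, ℂ)) :
    ∃ g : 𝓢(Vec n, ℂ), ∀ p, g p = Complex.I * ((lowerIdx p j / energy m p : ℝ) : ℂ) * f p := by
  refine ⟨Complex.I • SchwartzMap.smulLeftCLM ℂ
    (fun p : Vec n => ((lowerIdx p j / energy m p : ℝ) : ℂ)) f, fun p => ?_⟩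
  rw [smul_apply,
    SchwartzMap.smulLeftCLM_apply_apply (hasTemperateGrowth_velocity hm j)]
  simp [mul_assoc]

/-! ### Second quantization of multiplication operators and the Heisenberg equation -/

/-- The cycle `i.cycleRange` undoes moving the `i`-th variable to the front. -/
theorem apply_cons_removeNth_of_symmetric {n k : ℕ} {f : (Fin (k + 1) → Vec n) → ℂ}
    (hf : ∀ (σ : Equiv.Perm (Fin (k + 1))) (q : Fin (k + 1) → Vec n), f (q ∘ σ) = f q)
    (q : Fin (k + 1) → Vec n) (i : Fin (k + 1)) :
    f (Fin.cons (q i) (q ∘ i.succAbove)) = f q := by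
  rw [← hf i.cycleRange]
  congr 1
  funext l
  rw [Function.comp_apply, Fin.cons_apply_cycleRange (q i) (q ∘ i.succAbove) i l]
  exact congrFun (Fin.insertNth_self_removeNth i q) l

theorem cons_comp_perm {α : Type*} {k : ℕ} (p : α) (q : Fin k → α) (σ : Equiv.Perm (Fin k)) :
    (Fin.cons p (q ∘ σ) : Fin (k + 1) → α)
      = (Fin.cons p q : Fin (k + 1) → α) ∘ Equiv.Perm.decomposeFin.symm (0, σ) := by
  funext i
  refine Fin.cases ?_ (fun i => ?_) i <;> simp

/-- The permutation of the remaining variables induced by `σ` when the `i`-th one is removed. -/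
noncomputable def permRemoveNth {k : ℕ} (σ : Equiv.Perm (Fin (k + 1))) (i : Fin (k + 1)) :
    Equiv.Perm (Fin k) :=
  ((finSuccAboveEquiv i).trans
    (σ.subtypeEquiv fun a => (σ.injective.ne_iff (x := a) (y := i)).symm)).trans
    (finSuccAboveEquiv (σ i)).symm

theorem succAbove_permRemoveNth {k : ℕ} (σ : Equiv.Perm (Fin (k + 1))) (i : Fin (k + 1))
    (l : Fin k) : (σ i).succAbove (permRemoveNth σ i l) = σ (i.succAbove l) := by
  have h := (finSuccAboveEquiv (σ i)).apply_symm_apply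
    (σ.subtypeEquiv (fun a => (σ.injective.ne_iff (x := a) (y := i)).symm)
      (finSuccAboveEquiv i l))
  have h2 := congrArg Subtype.val h
  rw [finSuccAboveEquiv_apply] at h2
  exact h2

/-- Reindexing the sum by `σ` leaves the permutation `permRemoveNth σ i` of the remaining variables,
under which `F` is invariant. It is needed so that `P_0` acts on `X_j Ψ` as multiplication. -/
theorem creInt_symmetric {n : ℕ} (m : ℝ) {F : Vec n → WaveSeq n}
    (hF : ∀ p k (σ : Equiv.Perm (Fin k)) q, F p k (q ∘ σ) = F p k q) (k : ℕ)
    (σ : Equiv.Perm (Fin k)) (q : Fin k → Vec n) : creInt m F k (q ∘ σ) = creInt m F k q := by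
  cases k with
  | zero => rfl
  | succ k =>
    simp only [creInt]
    congr 1
    rw [← Equiv.sum_comp σ (fun i => (Real.sqrt (2 * energy m (q i)) : ℂ)
      * F (q i) k (q ∘ i.succAbove))]
    refine Finset.sum_congr rfl fun i _ => ?_
    have : (q ∘ σ) ∘ i.succAbove = (q ∘ (σ i).succAbove) ∘ permRemoveNth σ i := by
      funext l
      simp [succAbove_permRemoveNth]
    rw [this, hF]
    rfl

theorem creInt_const_smul {n : ℕ} (m : ℝ) (c : ℂ) (F : Vec n → WaveSeq n) :
    creInt m (fun p => c • F p) = c • creInt m F := by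
  funext k q
  cases k with
  | zero => simp [creInt]
  | succ k =>
    simp only [creInt, Pi.smul_apply, smul_eq_mul, Finset.mul_sum]
    exact Finset.sum_congr rfl fun i _ => by ring

theorem sqrt_two_mul_energy_ne_zero {n : ℕ} {m : ℝ} (hm : 0 < m) (p : Vec n) :
    (Real.sqrt (2 * energy m p) : ℂ) ≠ 0 := by
  have := energy_pos hm p
  exact_mod_cast (Real.sqrt_pos.2 (by positivity)).ne'

/-- `∫ dp a(p) a*(p) a(p)` is multiplication by `∑_i a(p_i)`, on symmetric wave functions. -/
theorem creInt_smul_ann {n : ℕ} {m : ℝ} (hm : 0 < m) (a : Vec n → ℂ) {Ψ : WaveSeq n} {k : ℕ}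
    (q : Fin k → Vec n) (hΨ : ∀ (σ : Equiv.Perm (Fin k)) (q : Fin k → Vec n), Ψ k (q ∘ σ) = Ψ k q) :
    creInt m (fun p => a p • ann m p Ψ) k q = (∑ i, a (q i)) * Ψ k q := by
  cases k with
  | zero => simp [creInt]
  | succ k =>
    simp only [creInt, ann, annCov, Pi.smul_apply, smul_eq_mul, Finset.mul_sum, Finset.sum_mul]
    refine Finset.sum_congr rfl fun i _ => ?_
    have h1 := apply_cons_removeNth_of_symmetric hΨ q i
    have h2 : (Real.sqrt (k + 1) : ℂ) ≠ 0 := by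
      exact_mod_cast (Real.sqrt_pos.2 (by positivity)).ne'
    have h3 := sqrt_two_mul_energy_ne_zero hm (q i)
    rw [h1]
    field_simp

theorem opV_apply {n : ℕ} {m : ℝ} (hm : 0 < m) (j : Fin n) {Ψ : WaveSeq n}
    (hΨ : IsSchwartzFock Ψ) (k : ℕ) (q : Fin k → Vec n) :
    opV m j Ψ k q = (∑ i, ((lowerIdx (q i) j / energy m (q i) : ℝ) : ℂ)) * Ψ k q :=
  creInt_smul_ann hm (fun p => ((lowerIdx p j / energy m p : ℝ) : ℂ)) q (hΨ.symmetric k)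

theorem opX_symmetric {n : ℕ} (m : ℝ) (j : Fin n) {Ψ : WaveSeq n} (hΨ : IsSchwartzFock Ψ) (k : ℕ)
    (σ : Equiv.Perm (Fin k)) (q : Fin k → Vec n) : opX m j Ψ k (q ∘ σ) = opX m j Ψ k q := by
  simp only [opX, Pi.smul_apply]
  rw [creInt_symmetric]
  intro p k σ q
  have h : ∀ p', ann m p' Ψ k (q ∘ σ) = ann m p' Ψ k q := by
    intro p'
    simp only [ann, annCov, Pi.smul_apply]
    rw [cons_comp_perm, hΨ.symmetric]
  simp only [h]

theorem hasFDerivAt_energy {n : ℕ} {m : ℝ} (hm : 0 < m) (p : Vec n) :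
    HasFDerivAt (energy m) ((energy m p)⁻¹ • innerSL ℝ p) p := by
  have h := ((hasStrictFDerivAt_norm_sq p).hasFDerivAt.add_const (m ^ 2)).sqrt
    (by positivity)
  convert! h using 1
  rw [energy]
  ext v
  simp
  field_simp

/-- `P_0` multiplies by the total energy on `X_j Ψ` as well as on `Ψ`, so only the derivative of
that energy survives the commutator. -/
theorem commutator_opP0_opX {n : ℕ} {m : ℝ} (hm : 0 < m) (j : Fin n) {Ψ : WaveSeq n}
    (hΨ : IsSchwartzFock Ψ) :
    opP0 m (opX m j Ψ) - opX m j (opP0 m Ψ) = (-Complex.I) • opV m j Ψ := by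
  funext k q
  simp only [Pi.sub_apply, Pi.smul_apply, smul_eq_mul]
  have hP : opP0 m (opX m j Ψ) k q = (∑ i, (energy m (q i) : ℂ)) * opX m j Ψ k q :=
    creInt_smul_ann hm (fun p => (energy m p : ℂ)) q (opX_symmetric m j hΨ k)
  rw [hP]
  cases k with
  | zero => simp [opX, opV, creInt]
  | succ k =>
    have hann : ∀ (p : Vec n) (q : Fin k → Vec n), ann m p (opP0 m Ψ) k q
        = ((energy m p : ℂ) + ∑ i, (energy m (q i) : ℂ)) * ann m p Ψ k q := by
      intro p q
      have h : opP0 m Ψ (k + 1) (Fin.cons p q) = _ :=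
        creInt_smul_ann hm (fun p => (energy m p : ℂ)) (Fin.cons p q) (hΨ.symmetric (k + 1))
      simp only [ann, annCov, Pi.smul_apply, smul_eq_mul]
      rw [h, Fin.sum_univ_succ]
      simp only [Fin.cons_zero, Fin.cons_succ]
      ring
    -- The product rule: the energy of the differentiated particle and those of the others add up to
    -- the total energy, and the extra term is `∂ω/∂p^j = -p_j/ω`.
    have hder : ∀ i : Fin (k + 1),
        fderiv ℝ (fun p' : Vec n => ann m p' (opP0 m Ψ) k (q ∘ i.succAbove)) (q i)
          (EuclideanSpace.single j (1 : ℝ))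
        = (∑ l, (energy m (q l) : ℂ)) *
          fderiv ℝ (fun p' : Vec n => ann m p' Ψ k (q ∘ i.succAbove)) (q i)
            (EuclideanSpace.single j (1 : ℝ))
          - ((lowerIdx (q i) j / energy m (q i) : ℝ) : ℂ) * ann m (q i) Ψ k (q ∘ i.succAbove) := by
      intro i
      obtain ⟨f, hf⟩ := hΨ.exists_schwartz_ann hm (q ∘ i.succAbove)
      simp only [hann, hf]
      have h1 : HasFDerivAt (fun p : Vec n => ((energy m p : ℝ) : ℂ)
          + ∑ l, (energy m ((q ∘ i.succAbove) l) : ℂ))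
          (Complex.ofRealCLM.comp ((energy m (q i))⁻¹ • innerSL ℝ (q i))) (q i) :=
        (Complex.ofRealCLM.hasFDerivAt.comp (q i) (hasFDerivAt_energy hm (q i))).add_const _
      have h2 := h1.mul (f.hasFDerivAt (q i))
      have h3 : fderiv ℝ (fun p : Vec n => (((energy m p : ℝ) : ℂ)
          + ∑ l, (energy m ((q ∘ i.succAbove) l) : ℂ)) * f p) (q i) = _ := h2.fderiv
      rw [h3, Fin.sum_univ_succAbove _ i]
      simp [EuclideanSpace.inner_single_right, lowerIdx]
      ring
    simp only [opX, opV, creInt, Pi.smul_apply, smul_eq_mul, hder, mul_sub, Finset.sum_sub_distrib]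
    have e : ∑ i : Fin (k + 1), (Real.sqrt (2 * energy m (q i)) : ℂ) *
        ((∑ l, (energy m (q l) : ℂ)) *
          fderiv ℝ (fun p' : Vec n => ann m p' Ψ k (q ∘ i.succAbove)) (q i)
            (EuclideanSpace.single j (1 : ℝ)))
        = (∑ l, (energy m (q l) : ℂ)) * ∑ i : Fin (k + 1), (Real.sqrt (2 * energy m (q i)) : ℂ) *
          fderiv ℝ (fun p' : Vec n => ann m p' Ψ k (q ∘ i.succAbove)) (q i)
            (EuclideanSpace.single j (1 : ℝ)) := by
      rw [Finset.mul_sum]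
      exact Finset.sum_congr rfl fun i _ => by ring
    rw [e]
    ring

/-! ### The velocity operator in coordinate space -/

/-- The normalization `(2π)^{-n/2}` of the Fourier transform. -/
noncomputable def fourierConst (n : ℕ) : ℝ := (2 * Real.pi) ^ (-(n : ℝ) / 2)

theorem fourierConst_mul_self (n : ℕ) :
    fourierConst n * (((2 * Real.pi) ^ n : ℝ) * fourierConst n) = 1 := by
  have h : (0 : ℝ) < 2 * Real.pi := by positivity
  rw [fourierConst, ← Real.rpow_natCast, ← Real.rpow_add h, ← Real.rpow_add h]
  ring_nf
  simp

theorem fourierConst_mul_self_complex (n : ℕ) :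
    (fourierConst n : ℂ) * ((((2 * Real.pi) ^ n : ℝ) : ℂ) * (fourierConst n : ℂ)) = 1 := by
  exact_mod_cast fourierConst_mul_self n

theorem SchwartzMap.integrable_norm_mul_norm {n : ℕ} (f : 𝓢(Vec n, ℂ)) :
    Integrable fun p => ‖p‖ * ‖f p‖ := by
  simpa using f.integrable_pow_mul (μ := volume) 1

section OneParticle

variable {n : ℕ} {m : ℝ} {Ψ : WaveSeq n} {k : ℕ} {q : Fin k → Vec n} {f : 𝓢(Vec n, ℂ)}

theorem annX_eq_waveSum (hf : ∀ p, ann m p Ψ k q = f p) (x : Vec n) :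
    annX m x Ψ k q = waveSum ((fourierConst n : ℂ) • f) x := by
  simp only [annX, hf, waveSum, smul_apply, smul_eq_mul]
  rw [← integral_const_mul]
  refine integral_congr_ae (ae_of_all _ fun p => ?_)
  simp only [planeWave, fourierConst]
  ring

theorem integrableOn_velConvIntegrand (hm : 0 < m) (j : Fin n)
    (hf : ∀ p, ann m p Ψ k q = f p) (x : Vec n) {ε : ℝ} (hε : 0 < ε) :
    IntegrableOn (velConvIntegrand m j Ψ x k q) {y : Vec n | ε < ‖x - y‖} := by
  have h : velConvIntegrand m j Ψ x k q
      = fun y => (velKernel m j (x - y) : ℂ) * waveSum ((fourierConst n : ℂ) • f) y := by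
    funext y
    rw [velConvIntegrand, annX_eq_waveSum hf]
  rw [h]
  exact integrableOn_velKernel_mul_waveSum hm j hε
    ((fourierConst n : ℂ) • f).integrable x

theorem tendsto_velConvTrunc_waveSum (hm : 0 < m) (j : Fin n)
    (hf : ∀ p, ann m p Ψ k q = f p) (x : Vec n) :
    Tendsto (fun ε => velConvTrunc m j ε x Ψ k q) (𝓝[>] (0 : ℝ))
      (𝓝 (waveSum (fun p => Complex.I * ((lowerIdx p j / energy m p : ℝ) : ℂ)
        * ((fourierConst n : ℂ) • f) p) x)) := by
  have h := tendsto_setIntegral_velKernel_mul_waveSum hm j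
    ((fourierConst n : ℂ) • f).integrable
    (SchwartzMap.integrable_norm_mul_norm ((fourierConst n : ℂ) • f)) x
  simpa only [velConvTrunc, velConvIntegrand, annX_eq_waveSum hf] using h

theorem velConv_eq_waveSum (hm : 0 < m) (j : Fin n)
    (hf : ∀ p, ann m p Ψ k q = f p) (x : Vec n) :
    velConv m j x Ψ k q = waveSum (fun p => Complex.I * ((lowerIdx p j / energy m p : ℝ) : ℂ)
        * ((fourierConst n : ℂ) • f) p) x :=
  (tendsto_velConvTrunc_waveSum hm j hf x).limUnder_eq

theorem tendsto_velConvTrunc (hm : 0 < m) (j : Fin n)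
    (hf : ∀ p, ann m p Ψ k q = f p) (x : Vec n) :
    Tendsto (fun ε => velConvTrunc m j ε x Ψ k q) (𝓝[>] (0 : ℝ)) (𝓝 (velConv m j x Ψ k q)) := by
  rw [velConv_eq_waveSum hm j hf]
  exact tendsto_velConvTrunc_waveSum hm j hf x

/-- The velocity multiplier has temperate growth, so the limit is again a superposition with
Schwartz amplitude; inversion and Plancherel then apply to it. -/
theorem exists_schwartz_velConv (hm : 0 < m) (j : Fin n)
    (hf : ∀ p, ann m p Ψ k q = f p) :
    ∃ g : 𝓢(Vec n, ℂ), (∀ p, g p = (fourierConst n : ℂ) *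
      (Complex.I * ((lowerIdx p j / energy m p : ℝ) : ℂ) * f p)) ∧
      ∀ x, velConv m j x Ψ k q = waveSum g x := by
  obtain ⟨g, hg⟩ := exists_schwartz_velocity_mul hm j ((fourierConst n : ℂ) • f)
  refine ⟨g, fun p => ?_, fun x => ?_⟩
  · rw [hg, smul_apply, smul_eq_mul]
    ring
  · rw [velConv_eq_waveSum hm j hf]
    congr 1
    exact funext fun p => (hg p).symm

theorem integrable_velConv (hm : 0 < m) (j : Fin n) (hf : ∀ p, ann m p Ψ k q = f p) :
    Integrable fun x : Vec n => velConv m j x Ψ k q := by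
  obtain ⟨g, -, hg⟩ := exists_schwartz_velConv hm j hf
  simp only [hg]
  exact integrable_waveSum g

/-- Fourier inversion recovers the amplitude, with the two factors `(2π)^{-n/2}` cancelling
`(2π)^n`. The `i` here meets the prefactor `-i` of the operator identity. -/
theorem fourier_velConv (hm : 0 < m) (j : Fin n) (hf : ∀ p, ann m p Ψ k q = f p) (p : Vec n) :
    (((2 * Real.pi) ^ (-(n : ℝ) / 2) : ℝ) : ℂ) *
      ∫ x : Vec n, Complex.exp (Complex.I * (contr p x : ℂ)) * velConv m j x Ψ k q
      = Complex.I * (((lowerIdx p j / energy m p : ℝ) : ℂ) * ann m p Ψ k q) := by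
  obtain ⟨g, hg1, hg⟩ := exists_schwartz_velConv hm j hf
  have h : ∀ x, Complex.exp (Complex.I * (contr p x : ℂ)) = conj (planeWave p x) := by
    intro x
    rw [planeWave, ← Complex.exp_conj]
    simp
  simp only [hg, h]
  rw [integral_conj_planeWave_mul_waveSum, hg1, hf]
  have h2 := fourierConst_mul_self_complex n
  have h3 : (((2 * Real.pi) ^ (-(n : ℝ) / 2) : ℝ) : ℂ) = (fourierConst n : ℂ) := rfl
  rw [h3]
  linear_combination (Complex.I * ((lowerIdx p j / energy m p : ℝ) : ℂ) * f p) * h2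

end OneParticle

theorem opV_eq_creIntX_velConv {n : ℕ} {m : ℝ} (hm : 0 < m) (j : Fin n) {Ψ : WaveSeq n}
    (hΨ : IsSchwartzFock Ψ) :
    opV m j Ψ = (-Complex.I) • creIntX m fun x => velConv m j x Ψ := by
  have h : (creIntX m fun x => velConv m j x Ψ) = Complex.I • opV m j Ψ := by
    rw [opV, ← creInt_const_smul, creIntX]
    congr 1
    funext p k q
    obtain ⟨f, hf⟩ := hΨ.exists_schwartz_ann hm q
    rw [fourier_velConv hm j hf]
    rfl
  rw [h, smul_smul]
  simp

/-! ### Integrability of products of wave functions -/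

theorem continuous_energy {n : ℕ} (m : ℝ) : Continuous (energy (n := n) m) := by
  unfold energy
  fun_prop

theorem le_energy {n : ℕ} (m : ℝ) (p : Vec n) : m ≤ energy m p :=
  Real.le_sqrt_of_sq_le (by nlinarith [sq_nonneg ‖p‖])

theorem norm_le_energy {n : ℕ} (m : ℝ) (p : Vec n) : ‖p‖ ≤ energy m p :=
  Real.le_sqrt_of_sq_le (by nlinarith [sq_nonneg m])

theorem abs_velocity_le_one {n : ℕ} {m : ℝ} (hm : 0 < m) (j : Fin n) (p : Vec n) :
    |lowerIdx p j / energy m p| ≤ 1 := by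
  rw [abs_div, abs_of_pos (energy_pos hm p), div_le_one (energy_pos hm p), lowerIdx, abs_neg]
  exact (abs_apply_le_norm p j).trans (norm_le_energy m p)

theorem continuous_velocity {n : ℕ} {m : ℝ} (hm : 0 < m) (j : Fin n) :
    Continuous fun p : Vec n => ((lowerIdx p j / energy m p : ℝ) : ℂ) :=
  Complex.continuous_ofReal.comp <| Continuous.div (by unfold lowerIdx; fun_prop)
    (continuous_energy m) fun p => (energy_pos hm p).ne'

/-- The weight of `dμ(p₁) ⋯ dμ(p_k)`. -/
noncomputable def fockWeight {n k : ℕ} (m : ℝ) (q : Fin k → Vec n) : ℝ := ∏ i, (2 * energy m (q i))⁻¹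

theorem fockWeight_nonneg {n k : ℕ} {m : ℝ} (hm : 0 < m) (q : Fin k → Vec n) :
    0 ≤ fockWeight m q :=
  Finset.prod_nonneg fun i _ => by have := energy_pos hm (q i); positivity

theorem fockWeight_le {n k : ℕ} {m : ℝ} (hm : 0 < m) (q : Fin k → Vec n) :
    fockWeight m q ≤ ((2 * m)⁻¹) ^ k := by
  have h : ∏ i : Fin k, (2 * energy m (q i))⁻¹ ≤ ∏ _i : Fin k, (2 * m)⁻¹ :=
    Finset.prod_le_prod (fun i _ => by have := energy_pos hm (q i); positivity) fun i _ => by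
      have := le_energy m (q i)
      gcongr
  rwa [Finset.prod_const, Finset.card_univ, Fintype.card_fin] at h

theorem continuous_fockWeight {n k : ℕ} {m : ℝ} (hm : 0 < m) :
    Continuous (fockWeight (n := n) (k := k) m) :=
  continuous_finsetProd _ fun i _ => Continuous.inv₀
    (continuous_const.mul ((continuous_energy m).comp (continuous_apply i)))
    fun q => by have := energy_pos hm (q i); positivity

theorem IsSchwartzFock.integrable_conj_mul {n : ℕ} {Φ Ψ : WaveSeq n} (hΦ : IsSchwartzFock Φ)
    (hΨ : IsSchwartzFock Ψ) (k : ℕ) : Integrable fun q => conj (Φ k q) * Ψ k q := by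
  obtain ⟨f, hf⟩ := hΦ.schwartz k
  obtain ⟨g, hg⟩ := hΨ.schwartz k
  simp only [hf, hg]
  -- Volume on configurations is the product measure; its Haar property supplies the integrability
  -- of Schwartz functions.
  have : (volume : Measure (Fin k → Vec n)).IsAddHaarMeasure := by
    change (Measure.pi fun _ => volume).IsAddHaarMeasure
    infer_instance
  refine g.integrable.bdd_mul (c := SchwartzMap.seminorm ℝ 0 0 f)
    (Complex.continuous_conj.comp f.continuous).aestronglyMeasurable (ae_of_all _ fun q => ?_)
  rw [RCLike.norm_conj]
  exact f.norm_le_seminorm ℝ q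

theorem measurePreserving_finCons (n k : ℕ) :
    MeasurePreserving (fun y : Vec n × (Fin k → Vec n) => (Fin.cons y.1 y.2 : Fin (k + 1) → Vec n)) := by
  have h := (volume_preserving_piFinSuccAbove (fun _ : Fin (k + 1) => Vec n) 0).symm
  convert! h using 1
  funext y
  simp [MeasurableEquiv.piFinSuccAbove, Fin.insertNthEquiv]

theorem measurableEmbedding_finCons (n k : ℕ) :
    MeasurableEmbedding
      (fun y : Vec n × (Fin k → Vec n) => (Fin.cons y.1 y.2 : Fin (k + 1) → Vec n)) := by
  have h := (MeasurableEquiv.piFinSuccAbove (fun _ : Fin (k + 1) => Vec n) 0).symm.measurableEmbedding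
  convert! h using 1
  funext y
  simp [MeasurableEquiv.piFinSuccAbove, Fin.insertNthEquiv]

theorem IsSchwartzFock.continuous_ann {n : ℕ} {m : ℝ} (hm : 0 < m) {Ψ : WaveSeq n}
    (hΨ : IsSchwartzFock Ψ) (k : ℕ) :
    Continuous fun y : Vec n × (Fin k → Vec n) => ann m y.1 Ψ k y.2 := by
  obtain ⟨f, hf⟩ := hΨ.schwartz (k + 1)
  simp only [ann, annCov, Pi.smul_apply, smul_eq_mul, hf]
  refine Continuous.mul (Continuous.inv₀ ?_ fun y => sqrt_two_mul_energy_ne_zero hm y.1)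
    (continuous_const.mul (f.continuous.comp ?_))
  · exact Complex.continuous_ofReal.comp
      (Real.continuous_sqrt.comp (continuous_const.mul ((continuous_energy m).comp continuous_fst)))
  · refine continuous_pi fun i => ?_
    refine Fin.cases ?_ (fun i => ?_) i
    · simp only [Fin.cons_zero]
      exact continuous_fst
    · simp only [Fin.cons_succ]
      exact (continuous_apply i).comp continuous_snd

/-- The factor `1/(2ω_p)` completes the weight of `k` particles to that of `k + 1`, and `k + 1`
counts the choices of the annihilated particle. -/
theorem conj_ann_mul_ann {n : ℕ} {m : ℝ} (hm : 0 < m) (Φ Ψ : WaveSeq n) (k : ℕ) (p : Vec n)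
    (q : Fin k → Vec n) : conj (ann m p Φ k q) * ann m p Ψ k q
      = ((((k : ℝ) + 1) * (2 * energy m p)⁻¹ : ℝ) : ℂ) *
        (conj (Φ (k + 1) (Fin.cons p q)) * Ψ (k + 1) (Fin.cons p q)) := by
  have h1 : ((Real.sqrt (k + 1) : ℝ) : ℂ) * (Real.sqrt (k + 1) : ℝ) = ((k : ℝ) + 1 : ℝ) := by
    rw [← Complex.ofReal_mul, Real.mul_self_sqrt (by positivity)]
  have h2 : ((Real.sqrt (2 * energy m p) : ℝ) : ℂ)⁻¹ * ((Real.sqrt (2 * energy m p) : ℝ) : ℂ)⁻¹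
      = ((2 * energy m p)⁻¹ : ℝ) := by
    have := energy_pos hm p
    rw [← mul_inv, ← Complex.ofReal_mul, Real.mul_self_sqrt (by positivity), Complex.ofReal_inv]
  simp only [ann, annCov, Pi.smul_apply, smul_eq_mul, map_mul, map_inv₀, Complex.conj_ofReal]
  rw [Complex.ofReal_mul, ← h1, ← h2]
  ring

theorem IsSchwartzFock.integrable_conj_ann_mul_ann {n : ℕ} {m : ℝ} (hm : 0 < m) {Φ Ψ : WaveSeq n}
    (hΦ : IsSchwartzFock Φ) (hΨ : IsSchwartzFock Ψ) (k : ℕ) :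
    Integrable (fun y : Vec n × (Fin k → Vec n) => conj (ann m y.1 Φ k y.2) * ann m y.1 Ψ k y.2)
      (volume.prod volume) := by
  have h : Integrable (fun y : Vec n × (Fin k → Vec n) =>
      conj (Φ (k + 1) (Fin.cons y.1 y.2)) * Ψ (k + 1) (Fin.cons y.1 y.2)) (volume.prod volume) :=
    ((measurePreserving_finCons n k).integrable_comp_emb (measurableEmbedding_finCons n k)).2
      (hΦ.integrable_conj_mul hΨ (k + 1))
  simp only [conj_ann_mul_ann hm]
  refine h.bdd_mul (c := ((k : ℝ) + 1) * (2 * m)⁻¹) ?_ (ae_of_all _ fun y => ?_)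
  · have h1 : Continuous fun y : Vec n × (Fin k → Vec n) => ((k : ℝ) + 1) * (2 * energy m y.1)⁻¹ :=
      continuous_const.mul (Continuous.inv₀
        (continuous_const.mul ((continuous_energy m).comp continuous_fst))
        fun y => by have := energy_pos hm y.1; positivity)
    exact (Complex.continuous_ofReal.comp h1).aestronglyMeasurable
  · have h1 := energy_pos hm y.1
    have h2 := le_energy m y.1
    rw [Complex.norm_real, Real.norm_of_nonneg (by positivity)]
    gcongr

/-! ### The form of the velocity operator in momentum space -/

theorem fockInner_eq_sum {n : ℕ} (m : ℝ) {Φ Ψ : WaveSeq n} {N : ℕ} (hΨ : ∀ k, N ≤ k → Ψ k = 0) :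
    fockInner m Φ Ψ = ∑ k ∈ Finset.range N,
      ∫ q : Fin k → Vec n, (fockWeight m q : ℂ) * (conj (Φ k q) * Ψ k q) := by
  rw [fockInner]
  refine tsum_eq_sum fun k hk => ?_
  have h : Ψ k = 0 := hΨ k (by simpa using hk)
  simp [h]

theorem IsSchwartzFock.exists_bound {n : ℕ} {Ψ : WaveSeq n} (hΨ : IsSchwartzFock Ψ) :
    ∃ N, ∀ k, N ≤ k → Ψ (k + 1) = 0 := by
  obtain ⟨N, hN⟩ := hΨ.finite
  exact ⟨N, fun k hk => hN _ (by omega)⟩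

theorem ann_eq_zero {n : ℕ} (m : ℝ) (p : Vec n) {Ψ : WaveSeq n} {k : ℕ} (h : Ψ (k + 1) = 0) :
    ann m p Ψ k = 0 := by
  funext q
  simp [ann, annCov, h]

/-- The transposition of `0` and `i` preserves both Lebesgue measure and `F`, so all terms of the
sum have the same integral. -/
theorem integral_sum_mul_of_symmetric {n k : ℕ} (v : Vec n → ℂ) {F : (Fin (k + 1) → Vec n) → ℂ}
    (hF : ∀ (σ : Equiv.Perm (Fin (k + 1))) (q : Fin (k + 1) → Vec n), F (q ∘ σ) = F q)
    (hi : Integrable fun q => v (q 0) * F q) :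
    ∫ q, (∑ i, v (q i)) * F q = ((k : ℂ) + 1) * ∫ q, v (q 0) * F q := by
  have hmp : ∀ i : Fin (k + 1), MeasurePreserving
      (MeasurableEquiv.piCongrLeft (fun _ : Fin (k + 1) => Vec n) (Equiv.swap 0 i)) :=
    fun i => volume_measurePreserving_piCongrLeft (fun _ => Vec n) (Equiv.swap 0 i)
  have hval : ∀ (i : Fin (k + 1)) (q : Fin (k + 1) → Vec n),
      MeasurableEquiv.piCongrLeft (fun _ : Fin (k + 1) => Vec n) (Equiv.swap 0 i) q
        = q ∘ Equiv.swap 0 i := by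
    intro i q
    funext l
    have := Equiv.piCongrLeft_apply_apply (P := fun _ : Fin (k + 1) => Vec n) (Equiv.swap 0 i) q
      (Equiv.swap 0 i l)
    rw [Equiv.swap_apply_self] at this
    simpa [MeasurableEquiv.coe_piCongrLeft] using this
  have hcomp : ∀ (i : Fin (k + 1)) (q : Fin (k + 1) → Vec n), v (q i) * F q
      = (fun q => v (q 0) * F q)
        (MeasurableEquiv.piCongrLeft (fun _ : Fin (k + 1) => Vec n) (Equiv.swap 0 i) q) := by
    intro i q
    simp only [hval, hF, Function.comp_apply, Equiv.swap_apply_left]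
  have hint : ∀ i : Fin (k + 1), Integrable fun q : Fin (k + 1) → Vec n => v (q i) * F q := by
    intro i
    simp only [hcomp i]
    exact ((hmp i).integrable_comp_emb (MeasurableEquiv.measurableEmbedding _)).2 hi
  have heq : ∀ i : Fin (k + 1), ∫ q : Fin (k + 1) → Vec n, v (q i) * F q
      = ∫ q, v (q 0) * F q := by
    intro i
    simp only [hcomp i]
    exact (hmp i).integral_comp (MeasurableEquiv.measurableEmbedding _) fun q => v (q 0) * F q
  simp only [Finset.sum_mul]
  rw [integral_finsetSum _ fun i _ => hint i]
  simp [heq]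

section Forms

variable {n : ℕ} {m : ℝ} {Φ Ψ : WaveSeq n}

theorem IsSchwartzFock.integrable_velocity_form (hm : 0 < m) (j : Fin n) (hΦ : IsSchwartzFock Φ)
    (hΨ : IsSchwartzFock Ψ) (k : ℕ) :
    Integrable (fun y : Vec n × (Fin k → Vec n) =>
      ((lowerIdx y.1 j / energy m y.1 : ℝ) : ℂ) * ((fockWeight m y.2 : ℂ) *
        (conj (ann m y.1 Φ k y.2) * ann m y.1 Ψ k y.2))) (volume.prod volume) := by
  refine Integrable.bdd_mul (c := 1) (Integrable.bdd_mul (c := ((2 * m)⁻¹) ^ k)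
    (hΦ.integrable_conj_ann_mul_ann hm hΨ k) ?_ (ae_of_all _ fun y => ?_)) ?_
    (ae_of_all _ fun y => ?_)
  · exact (Complex.continuous_ofReal.comp
      ((continuous_fockWeight hm).comp continuous_snd)).aestronglyMeasurable
  · rw [Complex.norm_real, Real.norm_of_nonneg (fockWeight_nonneg hm _)]
    exact fockWeight_le hm _
  · exact ((continuous_velocity hm j).comp continuous_fst).aestronglyMeasurable
  · rw [Complex.norm_real]
    exact abs_velocity_le_one hm j y.1

theorem integrable_velocity_form_component (hm : 0 < m) (j : Fin n) (hΦ : IsSchwartzFock Φ)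
    (hΨ : IsSchwartzFock Ψ) (k : ℕ) :
    Integrable fun p : Vec n => ((lowerIdx p j / energy m p : ℝ) : ℂ) *
      ∫ q : Fin k → Vec n, (fockWeight m q : ℂ) * (conj (ann m p Φ k q) * ann m p Ψ k q) := by
  have h := (hΦ.integrable_velocity_form hm j hΨ k).integral_prod_left
  simpa only [integral_const_mul] using h

/-- By symmetry the sum over particles is `k + 1` times the term of variable `0`. Splitting off that
variable as `p` absorbs `(k + 1)/(2ω_p)` into the two annihilation operators. -/
theorem integral_velocity_form_component (hm : 0 < m) (j : Fin n) (hΦ : IsSchwartzFock Φ)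
    (hΨ : IsSchwartzFock Ψ) (k : ℕ) :
    ∫ q : Fin (k + 1) → Vec n, (fockWeight m q : ℂ) * (conj (Φ (k + 1) q) * opV m j Ψ (k + 1) q)
      = ∫ p : Vec n, ((lowerIdx p j / energy m p : ℝ) : ℂ) *
        ∫ q : Fin k → Vec n, (fockWeight m q : ℂ) * (conj (ann m p Φ k q) * ann m p Ψ k q) := by
  set v : Vec n → ℂ := fun p => ((lowerIdx p j / energy m p : ℝ) : ℂ) with hv
  set F : (Fin (k + 1) → Vec n) → ℂ := fun q =>
    (fockWeight m q : ℂ) * (conj (Φ (k + 1) q) * Ψ (k + 1) q) with hFdef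
  have hF : ∀ (σ : Equiv.Perm (Fin (k + 1))) (q : Fin (k + 1) → Vec n), F (q ∘ σ) = F q := by
    intro σ q
    simp only [hFdef, hΦ.symmetric, hΨ.symmetric]
    congr 2
    exact Equiv.prod_comp σ fun i => (2 * energy m (q i))⁻¹
  have hcons : ∀ y : Vec n × (Fin k → Vec n),
      v y.1 * ((fockWeight m y.2 : ℂ) * (conj (ann m y.1 Φ k y.2) * ann m y.1 Ψ k y.2))
      = ((k : ℂ) + 1) * (fun q : Fin (k + 1) → Vec n => v (q 0) * F q) (Fin.cons y.1 y.2) := by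
    intro y
    have hw : fockWeight m (Fin.cons y.1 y.2 : Fin (k + 1) → Vec n)
        = (2 * energy m y.1)⁻¹ * fockWeight m y.2 := by
      simp [fockWeight, Fin.prod_univ_succ]
    simp only [hFdef, hw, Fin.cons_zero, conj_ann_mul_ann hm]
    push_cast
    ring
  have hk : ((k : ℂ) + 1) ≠ 0 := by exact_mod_cast Nat.succ_ne_zero k
  have hJ := hΦ.integrable_velocity_form hm j hΨ k
  have hi : Integrable fun q : Fin (k + 1) → Vec n => v (q 0) * F q := by
    refine ((measurePreserving_finCons n k).integrable_comp_emb
      (measurableEmbedding_finCons n k)).1 ?_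
    have h := hJ.const_mul ((k : ℂ) + 1)⁻¹
    refine h.congr (ae_of_all _ fun y => ?_)
    have := hcons y
    simp only [hv] at this
    simp only [this, hv, Function.comp_apply]
    field_simp
  calc ∫ q : Fin (k + 1) → Vec n, (fockWeight m q : ℂ) * (conj (Φ (k + 1) q) * opV m j Ψ (k + 1) q)
      = ∫ q : Fin (k + 1) → Vec n, (∑ i, v (q i)) * F q := by
        refine integral_congr_ae (ae_of_all _ fun q => ?_)
        simp only [opV_apply hm j hΨ, hFdef, hv]
        ring
    _ = ((k : ℂ) + 1) * ∫ q, v (q 0) * F q := integral_sum_mul_of_symmetric v hF hi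
    _ = ((k : ℂ) + 1) * ∫ y : Vec n × (Fin k → Vec n),
          (fun q : Fin (k + 1) → Vec n => v (q 0) * F q) (Fin.cons y.1 y.2) := by
        rw [← (measurePreserving_finCons n k).integral_comp (measurableEmbedding_finCons n k)]
    _ = ∫ y : Vec n × (Fin k → Vec n),
          v y.1 * ((fockWeight m y.2 : ℂ) * (conj (ann m y.1 Φ k y.2) * ann m y.1 Ψ k y.2)) := by
        rw [← integral_const_mul]
        exact integral_congr_ae (ae_of_all _ fun y => (hcons y).symm)
    _ = ∫ p : Vec n, ∫ q : Fin k → Vec n,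
          v p * ((fockWeight m q : ℂ) * (conj (ann m p Φ k q) * ann m p Ψ k q)) :=
        integral_prod _ hJ
    _ = _ := by simp only [hv, integral_const_mul]

theorem fockInner_opV (hm : 0 < m) (j : Fin n) (hΨ : IsSchwartzFock Ψ) {N : ℕ}
    (hN : ∀ k, N ≤ k → Ψ (k + 1) = 0) :
    fockInner m Φ (opV m j Ψ) = ∑ k ∈ Finset.range N, ∫ q : Fin (k + 1) → Vec n,
      (fockWeight m q : ℂ) * (conj (Φ (k + 1) q) * opV m j Ψ (k + 1) q) := by
  rw [fockInner_eq_sum m (N := N + 1), Finset.sum_range_succ']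
  -- The term split off is the vacuum component, where the sum over particles is empty.
  · simp [opV_apply hm j hΨ]
  · intro k hk
    obtain ⟨k, rfl⟩ : ∃ l, k = l + 1 := ⟨k - 1, by omega⟩
    funext q
    rw [opV_apply hm j hΨ, hN k (by omega)]
    simp

theorem velocity_form_eq_sum (j : Fin n) {N : ℕ} (hN : ∀ k, N ≤ k → Ψ (k + 1) = 0) :
    (fun p : Vec n =>
      ((lowerIdx p j / energy m p : ℝ) : ℂ) * fockInner m (ann m p Φ) (ann m p Ψ))
    = fun p => ∑ k ∈ Finset.range N, ((lowerIdx p j / energy m p : ℝ) : ℂ) *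
      ∫ q : Fin k → Vec n, (fockWeight m q : ℂ) * (conj (ann m p Φ k q) * ann m p Ψ k q) := by
  funext p
  rw [fockInner_eq_sum m fun k hk => ann_eq_zero m p (hN k hk), Finset.mul_sum]

theorem integrable_velocity_form (hm : 0 < m) (j : Fin n) (hΦ : IsSchwartzFock Φ)
    (hΨ : IsSchwartzFock Ψ) : Integrable fun p : Vec n =>
      ((lowerIdx p j / energy m p : ℝ) : ℂ) * fockInner m (ann m p Φ) (ann m p Ψ) := by
  obtain ⟨N, hN⟩ := hΨ.exists_bound
  rw [velocity_form_eq_sum j hN]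
  exact integrable_finsetSum _ fun k _ => integrable_velocity_form_component hm j hΦ hΨ k

theorem fockInner_opV_eq_integral (hm : 0 < m) (j : Fin n) (hΦ : IsSchwartzFock Φ)
    (hΨ : IsSchwartzFock Ψ) : fockInner m Φ (opV m j Ψ) = ∫ p : Vec n,
      ((lowerIdx p j / energy m p : ℝ) : ℂ) * fockInner m (ann m p Φ) (ann m p Ψ) := by
  obtain ⟨N, hN⟩ := hΨ.exists_bound
  rw [velocity_form_eq_sum j hN, fockInner_opV hm j hΨ hN,
    integral_finsetSum _ fun k _ => integrable_velocity_form_component hm j hΦ hΨ k]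
  exact Finset.sum_congr rfl fun k _ => integral_velocity_form_component hm j hΦ hΨ k

/-! ### The form of the velocity operator in coordinate space -/

/-- Joint measurability in `(x, q)`, which Fubini requires, is read off from a parameter integral
with jointly continuous integrand; the multiplier `a` covers both `ã` and its convolution. -/
theorem IsSchwartzFock.stronglyMeasurable_integral_planeWave_mul_ann (hm : 0 < m)
    (hΨ : IsSchwartzFock Ψ) (k : ℕ) {a : Vec n → ℂ} (ha : Continuous a) :
    StronglyMeasurable fun y : Vec n × (Fin k → Vec n) =>
      ∫ p, planeWave p y.1 * (a p * ann m p Ψ k y.2) := by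
  have h1 : Continuous fun z : (Vec n × (Fin k → Vec n)) × Vec n => planeWave z.2 z.1.1 :=
    continuous_planeWave.comp (continuous_snd.prodMk (continuous_fst.comp continuous_fst))
  have h3 : Continuous fun z : (Vec n × (Fin k → Vec n)) × Vec n => (z.2, z.1.2) :=
    continuous_snd.prodMk (continuous_snd.comp continuous_fst)
  have h2 := (hΨ.continuous_ann hm k).comp h3
  exact (h1.mul ((ha.comp continuous_snd).mul h2)).stronglyMeasurable.integral_prod_right'

theorem stronglyMeasurable_annX (hm : 0 < m) (hΨ : IsSchwartzFock Ψ) (k : ℕ) :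
    StronglyMeasurable fun y : Vec n × (Fin k → Vec n) => annX m y.1 Ψ k y.2 := by
  have h : (fun y : Vec n × (Fin k → Vec n) => annX m y.1 Ψ k y.2)
      = fun y => ∫ p, planeWave p y.1 * ((fourierConst n : ℂ) * ann m p Ψ k y.2) := by
    funext y
    obtain ⟨f, hf⟩ := hΨ.exists_schwartz_ann hm y.2
    rw [annX_eq_waveSum hf]
    simp only [waveSum, hf, smul_apply, smul_eq_mul]
  rw [h]
  exact hΨ.stronglyMeasurable_integral_planeWave_mul_ann hm k continuous_const

theorem stronglyMeasurable_velConv (hm : 0 < m) (j : Fin n) (hΨ : IsSchwartzFock Ψ) (k : ℕ) :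
    StronglyMeasurable fun y : Vec n × (Fin k → Vec n) => velConv m j y.1 Ψ k y.2 := by
  have h : (fun y : Vec n × (Fin k → Vec n) => velConv m j y.1 Ψ k y.2)
      = fun y => ∫ p, planeWave p y.1 * (Complex.I * ((lowerIdx p j / energy m p : ℝ) : ℂ)
        * (fourierConst n : ℂ) * ann m p Ψ k y.2) := by
    funext y
    obtain ⟨f, hf⟩ := hΨ.exists_schwartz_ann hm y.2
    rw [velConv_eq_waveSum hm j hf]
    simp only [waveSum, hf, smul_apply, smul_eq_mul, mul_assoc]
  rw [h]
  exact hΨ.stronglyMeasurable_integral_planeWave_mul_ann hm k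
    ((continuous_const.mul (continuous_velocity hm j)).mul continuous_const)

theorem integrable_conj_waveSum_mul_waveSum (f g : 𝓢(Vec n, ℂ)) :
    Integrable fun x => conj (waveSum f x) * waveSum g x := by
  refine (integrable_waveSum g).bdd_mul (c := ∫ p, ‖f p‖)
    (Complex.continuous_conj.comp (continuous_waveSum f.integrable)).aestronglyMeasurable
    (ae_of_all _ fun x => ?_)
  rw [RCLike.norm_conj]
  exact norm_waveSum_le f x

theorem integrable_sq_norm_waveSum (f : 𝓢(Vec n, ℂ)) : Integrable fun x => ‖waveSum f x‖ ^ 2 := by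
  refine (integrable_conj_waveSum_mul_waveSum f f).norm.congr (ae_of_all _ fun x => ?_)
  simp [sq]

theorem integral_sq_norm_waveSum (f : 𝓢(Vec n, ℂ)) :
    ∫ x, ‖waveSum f x‖ ^ 2 = (2 * Real.pi) ^ n * ∫ p, ‖f p‖ ^ 2 := by
  have h := integral_conj_waveSum_mul_waveSum f f
  simp only [Complex.conj_mul', ← Complex.ofReal_pow] at h
  rw [integral_complex_ofReal, integral_complex_ofReal] at h
  exact_mod_cast h

theorem norm_conj_mul_le (a b : ℂ) : ‖conj a * b‖ ≤ ‖a‖ ^ 2 + ‖b‖ ^ 2 := by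
  rw [norm_mul, RCLike.norm_conj]
  nlinarith [sq_nonneg (‖a‖ - ‖b‖), sq_nonneg ‖a‖, sq_nonneg ‖b‖]

/-- Plancherel at fixed `q`, after `|ab| ≤ |a|² + |b|²`; the velocity multiplier is at most `1` in
modulus. The bound uses only `L²` norms in `p`, which are integrable in `q`. -/
theorem integral_norm_conj_annX_mul_velConv_le (hm : 0 < m) (j : Fin n) {k : ℕ}
    {q : Fin k → Vec n} {f g : 𝓢(Vec n, ℂ)} (hf : ∀ p, ann m p Φ k q = f p)
    (hg : ∀ p, ann m p Ψ k q = g p) :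
    ∫ x, ‖conj (annX m x Φ k q) * velConv m j x Ψ k q‖
      ≤ (2 * Real.pi) ^ n * fourierConst n ^ 2 * (∫ p, ‖f p‖ ^ 2)
        + (2 * Real.pi) ^ n * fourierConst n ^ 2 * ∫ p, ‖g p‖ ^ 2 := by
  obtain ⟨h, hh1, hh⟩ := exists_schwartz_velConv hm j hg
  have hL2 : ∀ f : 𝓢(Vec n, ℂ), Integrable fun p => ‖f p‖ ^ 2 := by
    intro f
    refine (f.integrable.norm.mul_bdd (c := SchwartzMap.seminorm ℝ 0 0 f)
      f.continuous.norm.aestronglyMeasurable (ae_of_all _ fun p => ?_)).congr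
      (ae_of_all _ fun p => (sq _).symm)
    rw [norm_norm]
    exact f.norm_le_seminorm ℝ p
  simp only [annX_eq_waveSum hf, hh]
  have h1 : ∫ x, ‖waveSum ((fourierConst n : ℂ) • f) x‖ ^ 2
      = (2 * Real.pi) ^ n * fourierConst n ^ 2 * ∫ p, ‖f p‖ ^ 2 := by
    have := integral_sq_norm_waveSum ((fourierConst n : ℂ) • f)
    simp only [smul_apply, smul_eq_mul, norm_mul, mul_pow, integral_const_mul,
      Complex.norm_real, Real.norm_eq_abs, sq_abs] at this
    rw [mul_assoc, mul_pow, ← this]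
  have h2 : ∫ x, ‖waveSum h x‖ ^ 2
      ≤ (2 * Real.pi) ^ n * fourierConst n ^ 2 * ∫ p, ‖g p‖ ^ 2 := by
    rw [integral_sq_norm_waveSum, mul_assoc, ← integral_const_mul (fourierConst n ^ 2)]
    refine mul_le_mul_of_nonneg_left (integral_mono (hL2 h) ((hL2 g).const_mul _) fun p => ?_)
      (by positivity)
    simp only [hh1, norm_mul, mul_pow, Complex.norm_real, Complex.norm_I, Real.norm_eq_abs, sq_abs,
      one_mul]
    have h3 : (lowerIdx p j / energy m p) ^ 2 ≤ 1 := by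
      rw [← sq_abs]
      exact pow_le_one₀ (abs_nonneg _) (abs_velocity_le_one hm j p)
    exact mul_le_mul_of_nonneg_left (mul_le_of_le_one_left (by positivity) h3) (by positivity)
  refine (integral_mono (integrable_conj_waveSum_mul_waveSum _ h).norm
    ((integrable_sq_norm_waveSum _).add (integrable_sq_norm_waveSum h))
    fun x => norm_conj_mul_le _ _).trans ?_
  rw [integral_add' (integrable_sq_norm_waveSum _) (integrable_sq_norm_waveSum h), h1]
  gcongr

/-- The iterated criterion is applied with `x` integrated first, since Plancherel controls the
`x`-integral at fixed `q`. -/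
theorem integrable_conj_annX_mul_velConv (hm : 0 < m) (j : Fin n) (hΦ : IsSchwartzFock Φ)
    (hΨ : IsSchwartzFock Ψ) (k : ℕ) :
    Integrable (fun y : Vec n × (Fin k → Vec n) => (fockWeight m y.2 : ℂ) *
      (conj (annX m y.1 Φ k y.2) * velConv m j y.1 Ψ k y.2)) (volume.prod volume) := by
  have hmeas : AEStronglyMeasurable (fun y : Vec n × (Fin k → Vec n) =>
      conj (annX m y.1 Φ k y.2) * velConv m j y.1 Ψ k y.2) (volume.prod volume) :=
    ((Complex.continuous_conj.comp_stronglyMeasurable (stronglyMeasurable_annX hm hΦ k)).mul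
      (stronglyMeasurable_velConv hm j hΨ k)).aestronglyMeasurable
  refine Integrable.bdd_mul (c := ((2 * m)⁻¹) ^ k) ?_ (Complex.continuous_ofReal.comp
      ((continuous_fockWeight hm).comp continuous_snd)).aestronglyMeasurable
      (ae_of_all _ fun y => ?_)
  swap
  · rw [Complex.norm_real, Real.norm_of_nonneg (fockWeight_nonneg hm _)]
    exact fockWeight_le hm _
  rw [integrable_prod_iff' hmeas]
  constructor
  · refine ae_of_all _ fun q => ?_
    obtain ⟨f, hf⟩ := hΦ.exists_schwartz_ann hm q
    obtain ⟨g, hg⟩ := hΨ.exists_schwartz_ann hm q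
    obtain ⟨h, -, hh⟩ := exists_schwartz_velConv hm j hg
    simp only [annX_eq_waveSum hf, hh]
    exact integrable_conj_waveSum_mul_waveSum _ h
  -- The squared norm is the diagonal case of the products of annihilated wave functions, integrable
  -- in `(p, q)`.
  · have hsq : ∀ {Ψ : WaveSeq n}, IsSchwartzFock Ψ →
        Integrable fun q : Fin k → Vec n => ∫ p : Vec n, ‖ann m p Ψ k q‖ ^ 2 := by
      intro Ψ hΨ
      have h := (hΨ.integrable_conj_ann_mul_ann hm hΨ k).norm.integral_prod_right
      simpa [← sq] using h
    refine (((hsq hΦ).const_mul ((2 * Real.pi) ^ n * fourierConst n ^ 2)).add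
      ((hsq hΨ).const_mul ((2 * Real.pi) ^ n * fourierConst n ^ 2))).mono'
      hmeas.norm.prod_swap.integral_prod_right' (ae_of_all _ fun q => ?_)
    rw [Real.norm_of_nonneg (integral_nonneg fun x => norm_nonneg _)]
    obtain ⟨f, hf⟩ := hΦ.exists_schwartz_ann hm q
    obtain ⟨g, hg⟩ := hΨ.exists_schwartz_ann hm q
    simp only [Pi.add_apply, hf, hg]
    exact integral_norm_conj_annX_mul_velConv_le hm j hf hg

theorem integral_conj_annX_mul_velConv (hm : 0 < m) (j : Fin n) {k : ℕ}
    {q : Fin k → Vec n} {f g : 𝓢(Vec n, ℂ)} (hf : ∀ p, ann m p Φ k q = f p)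
    (hg : ∀ p, ann m p Ψ k q = g p) :
    ∫ x, conj (annX m x Φ k q) * velConv m j x Ψ k q
      = Complex.I * ∫ p, ((lowerIdx p j / energy m p : ℝ) : ℂ) *
        (conj (ann m p Φ k q) * ann m p Ψ k q) := by
  obtain ⟨h, hh1, hh⟩ := exists_schwartz_velConv hm j hg
  simp only [annX_eq_waveSum hf, hh, hf, hg]
  have h1 := integral_conj_waveSum_mul_waveSum ((fourierConst n : ℂ) • f) h
  refine h1.trans ?_
  rw [← integral_const_mul, ← integral_const_mul]
  refine integral_congr_ae (ae_of_all _ fun p => ?_)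
  simp only [hh1, smul_apply, smul_eq_mul, map_mul, Complex.conj_ofReal]
  linear_combination (Complex.I * ((lowerIdx p j / energy m p : ℝ) : ℂ) * (conj (f p) * g p)) *
    fourierConst_mul_self_complex n

/-- Both sides are rearranged to have `q` outermost, where the inner identity is Plancherel for
one-particle sections. -/
theorem integral_velConv_form_component (hm : 0 < m) (j : Fin n) (hΦ : IsSchwartzFock Φ)
    (hΨ : IsSchwartzFock Ψ) (k : ℕ) :
    ∫ x : Vec n, ∫ q : Fin k → Vec n, (fockWeight m q : ℂ) *
      (conj (annX m x Φ k q) * velConv m j x Ψ k q)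
    = Complex.I * ∫ p : Vec n, ((lowerIdx p j / energy m p : ℝ) : ℂ) *
        ∫ q : Fin k → Vec n, (fockWeight m q : ℂ) * (conj (ann m p Φ k q) * ann m p Ψ k q) := by
  rw [integral_integral_swap (integrable_conj_annX_mul_velConv hm j hΦ hΨ k)]
  have hsw := integral_integral_swap (f := fun (p : Vec n) (q : Fin k → Vec n) =>
    ((lowerIdx p j / energy m p : ℝ) : ℂ) * ((fockWeight m q : ℂ) *
      (conj (ann m p Φ k q) * ann m p Ψ k q))) (hΦ.integrable_velocity_form hm j hΨ k)
  simp only [integral_const_mul] at hsw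
  rw [hsw, ← integral_const_mul]
  refine integral_congr_ae (ae_of_all _ fun q => ?_)
  obtain ⟨f, hf⟩ := hΦ.exists_schwartz_ann hm q
  obtain ⟨g, hg⟩ := hΨ.exists_schwartz_ann hm q
  simp only
  rw [integral_const_mul, integral_conj_annX_mul_velConv hm j hf hg, mul_left_comm,
    ← integral_const_mul]
  congr 1
  exact integral_congr_ae (ae_of_all _ fun p => by ring)

theorem velConv_eq_zero (hm : 0 < m) (j : Fin n) (hΨ : IsSchwartzFock Ψ) {k : ℕ}
    (h : Ψ (k + 1) = 0) (x : Vec n) : velConv m j x Ψ k = 0 := by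
  funext q
  obtain ⟨f, hf⟩ := hΨ.exists_schwartz_ann hm q
  rw [velConv_eq_waveSum hm j hf]
  have h0 : ∀ p, f p = 0 := fun p => by rw [← hf, ann_eq_zero m p h]; rfl
  simp [waveSum, h0]

theorem velConv_form_eq_sum (hm : 0 < m) (j : Fin n) (hΨ : IsSchwartzFock Ψ) {N : ℕ}
    (hN : ∀ k, N ≤ k → Ψ (k + 1) = 0) :
    (fun x : Vec n => fockInner m (annX m x Φ) (velConv m j x Ψ))
    = fun x => ∑ k ∈ Finset.range N, ∫ q : Fin k → Vec n, (fockWeight m q : ℂ) *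
      (conj (annX m x Φ k q) * velConv m j x Ψ k q) :=
  funext fun x => fockInner_eq_sum m fun k hk => velConv_eq_zero hm j hΨ (hN k hk) x

theorem integrable_velConv_form (hm : 0 < m) (j : Fin n) (hΦ : IsSchwartzFock Φ)
    (hΨ : IsSchwartzFock Ψ) :
    Integrable fun x : Vec n => fockInner m (annX m x Φ) (velConv m j x Ψ) := by
  obtain ⟨N, hN⟩ := hΨ.exists_bound
  rw [velConv_form_eq_sum hm j hΨ hN]
  exact integrable_finsetSum _ fun k _ =>
    (integrable_conj_annX_mul_velConv hm j hΦ hΨ k).integral_prod_left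

theorem fockInner_opV_eq_integral_velConv (hm : 0 < m) (j : Fin n) (hΦ : IsSchwartzFock Φ)
    (hΨ : IsSchwartzFock Ψ) : fockInner m Φ (opV m j Ψ)
      = -Complex.I * ∫ x : Vec n, fockInner m (annX m x Φ) (velConv m j x Ψ) := by
  obtain ⟨N, hN⟩ := hΨ.exists_bound
  rw [velConv_form_eq_sum hm j hΨ hN, fockInner_opV hm j hΨ hN,
    integral_finsetSum _ fun k _ =>
      (integrable_conj_annX_mul_velConv hm j hΦ hΨ k).integral_prod_left, Finset.mul_sum]
  refine Finset.sum_congr rfl fun k _ => ?_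
  rw [integral_velocity_form_component hm j hΦ hΨ, integral_velConv_form_component hm j hΦ hΨ,
    ← mul_assoc]
  simp

end Forms

theorem mainTheorem6 (n : ℕ) (m : ℝ) (hm : 0 < m) (j : Fin n) :
    -- the convolution integral exists as a principal value
    (∀ Ψ : WaveSeq n, IsSchwartzFock Ψ → ∀ (x : Vec n) (k : ℕ) (q : Fin k → Vec n),
      (∀ ε : ℝ, 0 < ε →
        IntegrableOn (velConvIntegrand m j Ψ x k q) {y : Vec n | ε < ‖x - y‖}) ∧
      Tendsto (fun ε => velConvTrunc m j ε x Ψ k q) (𝓝[>] (0 : ℝ)) (𝓝 (velConv m j x Ψ k q))) ∧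
    -- the velocity operator in coordinate space, as an operator
    (∀ Ψ : WaveSeq n, IsSchwartzFock Ψ →
      (∀ (k : ℕ) (q : Fin k → Vec n), Integrable fun x : Vec n => velConv m j x Ψ k q) ∧
      opV m j Ψ = (-Complex.I) • creIntX m fun x => velConv m j x Ψ) ∧
    -- the velocity operator in momentum and in coordinate space, as a form
    (∀ Φ Ψ : WaveSeq n, IsSchwartzFock Φ → IsSchwartzFock Ψ →
      Integrable (fun p : Vec n =>
        ((lowerIdx p j / energy m p : ℝ) : ℂ) * fockInner m (ann m p Φ) (ann m p Ψ)) ∧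
      fockInner m Φ (opV m j Ψ) = ∫ p : Vec n,
        ((lowerIdx p j / energy m p : ℝ) : ℂ) * fockInner m (ann m p Φ) (ann m p Ψ) ∧
      Integrable (fun x : Vec n => fockInner m (annX m x Φ) (velConv m j x Ψ)) ∧
      fockInner m Φ (opV m j Ψ) =
        -Complex.I * ∫ x : Vec n, fockInner m (annX m x Φ) (velConv m j x Ψ)) ∧
    -- the Heisenberg equation
    (∀ Ψ : WaveSeq n, IsSchwartzFock Ψ →
      opP0 m (opX m j Ψ) - opX m j (opP0 m Ψ) = (-Complex.I) • opV m j Ψ) := by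
  refine ⟨fun Ψ hΨ x k q => ?_, fun Ψ hΨ => ⟨fun k q => ?_, opV_eq_creIntX_velConv hm j hΨ⟩,
    fun Φ Ψ hΦ hΨ => ⟨integrable_velocity_form hm j hΦ hΨ, fockInner_opV_eq_integral hm j hΦ hΨ,
      integrable_velConv_form hm j hΦ hΨ, fockInner_opV_eq_integral_velConv hm j hΦ hΨ⟩,
    fun Ψ hΨ => commutator_opP0_opX hm j hΨ⟩
  · obtain ⟨f, hf⟩ := hΨ.exists_schwartz_ann hm q
    exact ⟨fun ε hε => integrableOn_velConvIntegrand hm j hf x hε, tendsto_velConvTrunc hm j hf x⟩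
  · obtain ⟨f, hf⟩ := hΨ.exists_schwartz_ann hm q
    exact integrable_velConv hm j hf
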